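/- There exists a polyhedron in $\mathbb{R}^3$ (bounded by a connected, embedded, closed polyhedral surface) with the following three properties. 1. It is topologically convex, i.e. combinatorially equivalent to a convex polyhedron: for some convex polyhedron $C$ there is a bijection between the vertices of the polyhedron and those of $C$ under which the vertex sets of the faces of the polyhedron are exactly the vertex sets of the facets of $C$. 2. All its faces are acute isosceles triangles. 3. It is ununfoldable: it is not possible to cut its surface along a set of edges of the polyhedron so that the surface remains in one piece (any two faces are connected through a sequence of faces in which consecutive ones share an uncut edge) and can be unfolded into the plane without overlap, i.e. with every face laid out as a congruent triangle, faces sharing an uncut edge attached along that edge, and distinct faces having disjoint interiors. -/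

import Mathlib

/-- Euclidean space `ℝ³`. -/
abbrev Space : Type := EuclideanSpace ℝ (Fin 3)

/-- The Euclidean plane `ℝ²`. -/
abbrev Plane : Type := EuclideanSpace ℝ (Fin 2)

/-- A polyhedron in `ℝ³` with triangular faces, given by its surface: a connected, embedded,
closed triangulated surface with finitely many faces. `V` is the set of vertices, `pos` their
positions, and a face is recorded by the set of its three vertices. -/
structure TriPolyhedron (V : Type) [Fintype V] [DecidableEq V] where
  /-- the position of a vertex -/
  pos : V → Space
  /-- the faces -/
  faces : Finset (Finset V)
  nonempty : faces.Nonempty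
  card_face : ∀ f ∈ faces, f.card = 3
  /-- every vertex is the vertex of some face -/
  exists_face : ∀ v : V, ∃ f ∈ faces, v ∈ f
  /-- faces are nondegenerate triangles -/
  nondegenerate : ∀ f ∈ faces, AffineIndependent ℝ (fun v : f => pos v)
  /-- no self-intersection: two faces meet exactly in the face, edge or vertex spanned by their
  common vertices, and are disjoint if there is none -/
  embedded : ∀ f ∈ faces, ∀ g ∈ faces,
    convexHull ℝ (pos '' (f : Set V)) ∩ convexHull ℝ (pos '' (g : Set V))
      ⊆ convexHull ℝ (pos '' ((f ∩ g : Finset V) : Set V))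
  /-- each edge lies in exactly two faces -/
  closed : ∀ f ∈ faces, ∀ e ⊆ f, e.card = 2 → (faces.filter (fun g => e ⊆ g)).card = 2
  /-- the faces around a vertex form a single cycle -/
  link_connected : ∀ v : V, ∀ f ∈ faces, ∀ g ∈ faces, v ∈ f → v ∈ g →
    Relation.ReflTransGen
      (fun a b => a ∈ faces ∧ b ∈ faces ∧ v ∈ a ∩ b ∧ (a ∩ b).card = 2) f g
  /-- the surface is connected -/
  connected : ∀ f ∈ faces, ∀ g ∈ faces,
    Relation.ReflTransGen (fun a b => a ∈ faces ∧ b ∈ faces ∧ (a ∩ b).card = 2) f g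
  /-- adjacent faces lie in different planes, so the triangles are the true faces -/
  not_coplanar : ∀ f ∈ faces, ∀ g ∈ faces, (f ∩ g).card = 2 →
    ¬ Coplanar ℝ (pos '' ((f ∪ g : Finset V) : Set V))

/-- A convex polyhedron: the convex hull of finitely many points, with nonempty interior. -/
def IsConvexPolyhedron (C : Set Space) : Prop :=
  (∃ T : Set Space, T.Finite ∧ C = convexHull ℝ T) ∧ (interior C).Nonempty

/-- `G` is a facet (a two-dimensional face) of the convex set `C`: the set of maximizers on `C`
of some linear functional, of dimension two. -/
def IsFacet (C G : Set Space) : Prop :=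
  IsExposed ℝ C G ∧ Module.finrank ℝ (vectorSpan ℝ G) = 2

namespace TriPolyhedron

variable {V : Type} [Fintype V] [DecidableEq V]

/-- `P` is combinatorially equivalent to the convex polyhedron `C`: there is a bijection from the
vertices of `P` to the vertices of `C` under which the vertex sets of the faces of `P` are exactly
the vertex sets of the facets of `C`. -/
def CombEquiv (P : TriPolyhedron V) (C : Set Space) : Prop :=
  ∃ e : V ≃ (Set.extremePoints ℝ C : Set Space), ∀ S : Finset V,
    S ∈ P.faces ↔ ∃ G : Set Space, IsFacet C G ∧ ∀ v : V, v ∈ S ↔ (e v : Space) ∈ G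

/-- Topologically convex: combinatorially equivalent to a convex polyhedron. -/
def IsTopologicallyConvex (P : TriPolyhedron V) : Prop :=
  ∃ C : Set Space, IsConvexPolyhedron C ∧ P.CombEquiv C

/-- All angles of the triangle `f` are less than `π / 2`. -/
def IsAcuteFace (P : TriPolyhedron V) (f : Finset V) : Prop :=
  ∀ a ∈ f, ∀ b ∈ f, ∀ c ∈ f, a ≠ b → b ≠ c → a ≠ c →
    EuclideanGeometry.angle (P.pos a) (P.pos b) (P.pos c) < Real.pi / 2

/-- The triangle `f` has two sides of equal length. -/
def IsIsoscelesFace (P : TriPolyhedron V) (f : Finset V) : Prop :=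
  ∃ a ∈ f, ∃ b ∈ f, ∃ c ∈ f, a ≠ b ∧ b ≠ c ∧ a ≠ c ∧
    dist (P.pos a) (P.pos b) = dist (P.pos a) (P.pos c)

/-- The edges of `P`, as two-element sets of vertices. -/
def IsEdge (P : TriPolyhedron V) (e : Finset V) : Prop :=
  e.card = 2 ∧ ∃ f ∈ P.faces, e ⊆ f

/-- The distinct faces `f` and `g` share an edge that does not belong to `cut`. -/
def Joined (P : TriPolyhedron V) (cut : Set (Finset V)) (f g : Finset V) : Prop :=
  f ∈ P.faces ∧ g ∈ P.faces ∧ (f ∩ g).card = 2 ∧ f ∩ g ∉ cut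

/-- A nonoverlapping edge unfolding of `P`, possibly into several pieces: the surface is cut along
a set of edges, and all faces are laid out in the plane as congruent triangles, such that faces
sharing an uncut edge stay attached along it and no two faces overlap. Boundaries may touch.
Faces attached along an edge lie on opposite sides of it, since they do not overlap; so within
a piece no face is turned over. -/
structure EdgeUnfolding (P : TriPolyhedron V) where
  /-- the edges that are cut -/
  cut : Set (Finset V)
  isEdge_of_mem_cut : ∀ e ∈ cut, P.IsEdge e
  /-- `place f v` is the position in the plane of the vertex `v` of the face `f`;
  values with `v ∉ f` play no role -/
  place : Finset V → V → Plane
  congruent : ∀ f ∈ P.faces, ∀ a ∈ f, ∀ b ∈ f,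
    dist (place f a) (place f b) = dist (P.pos a) (P.pos b)
  attached : ∀ f g, P.Joined cut f g → ∀ v ∈ f ∩ g, place f v = place g v
  nonoverlapping : ∀ f ∈ P.faces, ∀ g ∈ P.faces, f ≠ g →
    Disjoint (interior (convexHull ℝ (place f '' (f : Set V))))
      (interior (convexHull ℝ (place g '' (g : Set V))))

/-- The unfolding consists of a single piece: any two faces are connected through uncut edges. -/
def EdgeUnfolding.IsSinglePiece {P : TriPolyhedron V} (U : P.EdgeUnfolding) : Prop :=
  ∀ f ∈ P.faces, ∀ g ∈ P.faces, Relation.ReflTransGen (P.Joined U.cut) f g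

/-- `P` is ununfoldable: it has no nonoverlapping edge unfolding into a single piece. -/
def IsUnunfoldable (P : TriPolyhedron V) : Prop :=
  ¬ ∃ U : P.EdgeUnfolding, U.IsSinglePiece

end TriPolyhedron

/-! The polyhedron is a cube with four alternate vertices replaced by hats. A hat consists of a
sharp three-sided spike, with apex a and base vertices b_0, b_1, b_2, and a brim of six triangles
reaching to three corners. The four hats meet along six rim edges between corners. Altogether there
are 36 faces, and each hat has 12 interior edges.

Ununfoldability is a count. In a single piece the uncut edges connect 36 faces, so there are at
least 35 of them. At most 6 lie on rims, so it suffices that every hat has at most 7 uncut interior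
edges, that is, at least 5 cut ones: then there are at most 6 + 4 * 7 = 34.

The five face angles at a brim vertex b_i add up to about 421 degrees. If only one edge there is
cut, the first and last face around b_i overlap; so at least two of its five edges are cut
(`false_of_cut_apex_edge`, `false_of_cut_brim_edge`, `false_of_cut_corner_edge`). The angles at a
add up to far less than a full turn, so at least one edge there is cut (`false_of_uncut_spike`).
Finally, no set of spike faces may be separated from the rest, so the cut edges among a, b_0, b_1,
b_2 contain no cycle and number at most three. The cut degrees of these four vertices add up to at
least 1 + 2 + 2 + 2 = 7, hence there are at least four cuts. Exactly four are possible only for a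
path from a through all three brim vertices to a corner, and `false_of_hamiltonian_cut` excludes
this: the unrolled brim hits the spike.

The integer coordinates are chosen so that each face has rational coordinates in a frame on one of
its sides. All layouts are therefore exact rational computations.

The surface is star-shaped about the origin. Radial scaling of the vertices turns it into the
boundary of a convex polyhedron with triangles over the same cones (`IsConvexFan`), which gives both
topological convexity and embeddedness. -/

set_option linter.unusedSectionVars false

/-! ### Triangulated boundaries of convex polyhedra around the origin -/

section Fan

variable {V : Type} [Fintype V] [DecidableEq V]

/-- Weights are indexed by all vertices, with zeros off `f`, so that representations over different
triangles can be compared directly. -/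
theorem mem_convexHull_image_finset_iff (p : V → Space) (f : Finset V) (x : Space) :
    x ∈ convexHull ℝ (p '' (f : Set V)) ↔
      ∃ α : V → ℝ, (∀ v, 0 ≤ α v) ∧ (∀ v, v ∉ f → α v = 0) ∧ ∑ v, α v = 1 ∧
        ∑ v, α v • p v = x := by
  constructor
  · intro hx
    refine convexHull_min (t := {x | ∃ α : V → ℝ, (∀ v, 0 ≤ α v) ∧ (∀ v, v ∉ f → α v = 0) ∧
      ∑ v, α v = 1 ∧ ∑ v, α v • p v = x}) ?_ ?_ hx
    · rintro _ ⟨v, hv, rfl⟩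
      refine ⟨Pi.single v 1, fun u => ?_, fun u hu => ?_, ?_, ?_⟩
      · by_cases h : u = v
        · subst h; simp
        · simp [h]
      · have : u ≠ v := by rintro rfl; exact hu hv
        simp [this]
      · simp
      · simp [Pi.single_apply]
    · rintro _ ⟨α, h0, hf, h1, rfl⟩ _ ⟨β, k0, kf, k1, rfl⟩ a b ha hb hab
      refine ⟨fun v => a * α v + b * β v, fun v => ?_, fun v hv => ?_, ?_, ?_⟩
      · have := h0 v; have := k0 v; positivity
      · simp [hf v hv, kf v hv]
      · rw [Finset.sum_add_distrib, ← Finset.mul_sum, ← Finset.mul_sum, h1, k1]; linarith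
      · simp only [add_smul, mul_smul, Finset.sum_add_distrib, Finset.smul_sum]
  · rintro ⟨α, h0, hf, h1, rfl⟩
    rw [← Finset.sum_subset (Finset.subset_univ f) (fun v _ hv => by simp [hf v hv])]
    refine (convex_convexHull ℝ _).sum_mem (fun v _ => h0 v) ?_
      (fun v hv => subset_convexHull ℝ _ ⟨v, hv, rfl⟩)
    rw [← h1, Finset.sum_subset (Finset.subset_univ f) (fun v _ hv => hf v hv)]

variable {ι : Type} [Fintype ι]

/-- The triangles `w (tri i 0) w (tri i 1) w (tri i 2)` are facets of the convex hull of the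
points `w v`, exposed by the functionals `ℓ i`, and every edge of a triangle belongs to a
second triangle. -/
structure IsConvexFan (w : V → Space) (tri : ι → Fin 3 → V) (ℓ : ι → Space →L[ℝ] ℝ) : Prop where
  nonempty : Nonempty ι
  eq_one : ∀ i k, ℓ i (w (tri i k)) = 1
  lt_one : ∀ i v, (∀ k, v ≠ tri i k) → ℓ i (w v) < 1
  linearIndependent : ∀ i, LinearIndependent ℝ (fun k => w (tri i k))
  exists_neighbor : ∀ i k, ∃ j, (∀ k', k' ≠ k → ∃ l, tri i k' = tri j l) ∧
    ∀ l, tri i k ≠ tri j l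

namespace IsConvexFan

variable {w : V → Space} {tri : ι → Fin 3 → V} {ℓ : ι → Space →L[ℝ] ℝ}

theorem le_one (h : IsConvexFan w tri ℓ) (i : ι) (v : V) : ℓ i (w v) ≤ 1 := by
  by_cases hv : ∀ k, v ≠ tri i k
  · exact (h.lt_one i v hv).le
  · push Not at hv
    obtain ⟨k, rfl⟩ := hv
    exact (h.eq_one i k).le

theorem exists_coords (h : IsConvexFan w tri ℓ) (i : ι) (x : Space) :
    ∃ μ : Fin 3 → ℝ, x = ∑ k, μ k • w (tri i k) := by
  have hs := (h.linearIndependent i).span_eq_top_of_card_eq_finrank' (by simp)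
  have hx : x ∈ Submodule.span ℝ (Set.range fun k => w (tri i k)) := by rw [hs]; trivial
  obtain ⟨μ, hμ⟩ := (Submodule.mem_span_range_iff_exists_fun ℝ).1 hx
  exact ⟨μ, hμ.symm⟩

theorem eq_of_apply_eq (h : IsConvexFan w tri ℓ) (i : ι) {m m' : Space →L[ℝ] ℝ}
    (hm : ∀ k, m (w (tri i k)) = m' (w (tri i k))) : m = m' := by
  ext x
  obtain ⟨μ, rfl⟩ := h.exists_coords i x
  simp [map_sum, hm]

/-- The cones spanned by the triangles cover space. -/
theorem exists_cone (h : IsConvexFan w tri ℓ) (x : Space) :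
    ∃ i, ∃ μ : Fin 3 → ℝ, (∀ k, 0 ≤ μ k) ∧ x = ∑ k, μ k • w (tri i k) := by
  have := h.nonempty
  obtain ⟨i, -, hi⟩ := Finset.exists_max_image Finset.univ (fun i => ℓ i x) Finset.univ_nonempty
  obtain ⟨μ, hμ⟩ := h.exists_coords i x
  refine ⟨i, μ, fun k => ?_, hμ⟩
  obtain ⟨j, hj, hjk⟩ := h.exists_neighbor i k
  have hlt := h.lt_one j (tri i k) hjk
  have hij := hi j (Finset.mem_univ _)
  -- Passing to the neighbour across the edge opposite to vertex `k` changes the value only through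
  -- `μ k`, with a negative factor. Since `ℓ i x` is maximal, `μ k` cannot be negative.
  have key : ℓ j x = ℓ i x + μ k * (ℓ j (w (tri i k)) - 1) := by
    have e : ∀ k', μ k' * ℓ j (w (tri i k')) =
        μ k' + if k' = k then μ k * (ℓ j (w (tri i k)) - 1) else 0 := by
      intro k'
      by_cases hk : k' = k
      · subst hk; simp; ring
      · obtain ⟨l, hl⟩ := hj k' hk
        simp [hk, hl, h.eq_one]
    rw [hμ]
    simp only [map_sum, map_smul, smul_eq_mul, h.eq_one, mul_one]
    simp only [e, Finset.sum_add_distrib, Finset.sum_ite_eq', Finset.mem_univ, if_true]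
  nlinarith

/-- Two representations of a point as a nonnegative combination, one of them supported by a
triangle, have the same support there. -/
theorem eq_zero_of_sum_eq (h : IsConvexFan w tri ℓ) {i j : ι} {α β : V → ℝ} (hα : ∀ v, 0 ≤ α v)
    (hβ : ∀ v, 0 ≤ β v) (hαi : ∀ v, (∀ k, v ≠ tri i k) → α v = 0)
    (hβj : ∀ v, (∀ k, v ≠ tri j k) → β v = 0)
    (hs : ∑ v, α v • w v = ∑ v, β v • w v) (v : V) (hv : ∀ k, v ≠ tri i k) : β v = 0 := by
  have own : ∀ (i : ι) (α : V → ℝ), (∀ v, (∀ k, v ≠ tri i k) → α v = 0) →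
      ℓ i (∑ v, α v • w v) = ∑ v, α v := by
    intro i α hα
    simp only [map_sum, map_smul, smul_eq_mul]
    refine Finset.sum_congr rfl fun v _ => ?_
    by_cases hv : ∀ k, v ≠ tri i k
    · simp [hα v hv]
    · push Not at hv
      obtain ⟨k, rfl⟩ := hv
      simp [h.eq_one]
  have le : ∀ (i : ι) (α : V → ℝ), (∀ v, 0 ≤ α v) → ℓ i (∑ v, α v • w v) ≤ ∑ v, α v := by
    intro i α hα
    simp only [map_sum, map_smul, smul_eq_mul]
    exact Finset.sum_le_sum fun v _ => mul_le_of_le_one_right (hα v) (h.le_one i v)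
  -- Testing the common point with `ℓ j` gives ∑ β ≤ ∑ α. Testing it with `ℓ i` shows that the sum
  -- of the nonnegative terms β v (1 - ℓ i (w v)) is ∑ β - ∑ α, so every term vanishes.
  have h1 := le j α hα
  rw [hs, own j β hβj] at h1
  have h2 : ∑ v, β v * (1 - ℓ i (w v)) = 0 := by
    refine le_antisymm ?_ (Finset.sum_nonneg fun v _ =>
      mul_nonneg (hβ v) (sub_nonneg.2 (h.le_one i v)))
    have h3 := own i α hαi
    rw [hs] at h3
    simp only [map_sum, map_smul, smul_eq_mul] at h3
    simp only [mul_sub, mul_one, Finset.sum_sub_distrib]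
    linarith
  have h4 := (Finset.sum_eq_zero_iff_of_nonneg fun v _ =>
    mul_nonneg (hβ v) (sub_nonneg.2 (h.le_one i v))).1 h2 v (Finset.mem_univ v)
  exact (mul_eq_zero.1 h4).resolve_right (sub_pos.2 (h.lt_one i v hv)).ne'

/-- Triangles over a convex fan meet in common faces. -/
theorem convexHull_inter_subset (h : IsConvexFan w tri ℓ) {pos : V → Space} {κ : V → ℝ}
    (hκ : ∀ v, 0 < κ v) (hw : ∀ v, w v = κ v • pos v) (i j : ι) :
    convexHull ℝ (pos '' (Finset.univ.image (tri i) : Finset V)) ∩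
        convexHull ℝ (pos '' (Finset.univ.image (tri j) : Finset V)) ⊆
      convexHull ℝ (pos ''
        ((Finset.univ.image (tri i) ∩ Finset.univ.image (tri j) : Finset V) : Set V)) := by
  rintro x ⟨hi, hj⟩
  rw [mem_convexHull_image_finset_iff] at hi hj ⊢
  obtain ⟨α, α0, αi, -, αx⟩ := hi
  obtain ⟨β, β0, βj, β1, βx⟩ := hj
  have mem : ∀ (i : ι) (v : V), (∀ k, v ≠ tri i k) → v ∉ Finset.univ.image (tri i) := by
    intro i v hv hm
    obtain ⟨k, -, hk⟩ := Finset.mem_image.1 hm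
    exact hv k hk.symm
  -- Over the scaled vertices the weights become α / κ. They no longer add up to 1, which is why the
  -- comparison is made for cones.
  have resc : ∀ α : V → ℝ, ∑ v, (α v / κ v) • w v = ∑ v, α v • pos v := fun α =>
    Finset.sum_congr rfl fun v _ => by rw [hw, smul_smul, div_mul_cancel₀ _ (hκ v).ne']
  have key := h.eq_zero_of_sum_eq (i := i) (j := j) (α := fun v => α v / κ v)
    (β := fun v => β v / κ v) (fun v => div_nonneg (α0 v) (hκ v).le)
    (fun v => div_nonneg (β0 v) (hκ v).le) (fun v hv => by simp [αi v (mem i v hv)])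
    (fun v hv => by simp [βj v (mem j v hv)]) (by rw [resc, resc, αx, βx])
  refine ⟨β, β0, fun v hv => ?_, β1, βx⟩
  rw [Finset.mem_inter, not_and_or] at hv
  rcases hv with hv | hv
  · have := key v fun k hk => hv (Finset.mem_image.2 ⟨k, Finset.mem_univ _, hk.symm⟩)
    exact (div_eq_zero_iff.1 this).resolve_right (hκ v).ne'
  · exact βj v hv

theorem apply_le_one (h : IsConvexFan w tri ℓ) (i : ι) {x : Space}
    (hx : x ∈ convexHull ℝ (Set.range w)) : ℓ i x ≤ 1 := by
  refine convexHull_min (t := {x | ℓ i x ≤ 1}) ?_ ?_ hx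
  · rintro _ ⟨v, rfl⟩
    exact h.le_one i v
  · exact convex_halfSpace_le (ℓ i).isLinear 1

/-- A vertex `o` off the plane of triangle `i` has coordinates of sum less than 1 in the basis given
by that triangle. This allows each basis vector to be solved for in terms of differences of
vertices. -/
theorem vectorSpan_range_eq_top (h : IsConvexFan w tri ℓ) :
    vectorSpan ℝ (Set.range w) = ⊤ := by
  obtain ⟨j⟩ := h.nonempty
  obtain ⟨i, -, hi⟩ := h.exists_neighbor j 0
  have ho := h.lt_one i (tri j 0) hi
  set o := tri j 0
  rw [eq_top_iff, ← (h.linearIndependent i).span_eq_top_of_card_eq_finrank' (by simp),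
    Submodule.span_le]
  have mem : ∀ u v, w u - w v ∈ vectorSpan ℝ (Set.range w) := fun u v =>
    vsub_mem_vectorSpan ℝ ⟨u, rfl⟩ ⟨v, rfl⟩
  rintro _ ⟨l, rfl⟩
  obtain ⟨μ, hμ⟩ := h.exists_coords i (w o)
  have hsum : ∑ k, μ k < 1 := by
    have : ℓ i (w o) = ∑ k, μ k := by rw [hμ]; simp [h.eq_one]
    rwa [← this]
  have key : (1 - ∑ k, μ k) • w (tri i l) =
      (w (tri i l) - w o) + ∑ k, μ k • (w (tri i k) - w (tri i l)) := by
    simp only [smul_sub, Finset.sum_sub_distrib, ← hμ, ← Finset.sum_smul, sub_smul, one_smul]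
    abel
  rw [SetLike.mem_coe, ← Submodule.smul_mem_iff _ (sub_pos.2 hsum).ne', key]
  exact Submodule.add_mem _ (mem _ _)
    (Submodule.sum_mem _ fun k _ => Submodule.smul_mem _ _ (mem _ _))

theorem isConvexPolyhedron (h : IsConvexFan w tri ℓ) :
    IsConvexPolyhedron (convexHull ℝ (Set.range w)) := by
  refine ⟨⟨_, Set.finite_range w, rfl⟩, ?_⟩
  obtain ⟨i⟩ := h.nonempty
  have hne : (Set.range w).Nonempty := ⟨_, tri i 0, rfl⟩
  rw [interior_convexHull_nonempty_iff_affineSpan_eq_top,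
    AffineSubspace.affineSpan_eq_top_iff_vectorSpan_eq_top_of_nonempty ℝ _ _ hne]
  exact h.vectorSpan_range_eq_top

end IsConvexFan

/-- A point of a convex hull at which a functional attains its maximum over the generators is
a convex combination of maximizing generators. -/
theorem exists_weights_of_apply_eq {w : V → Space} {m : Space →L[ℝ] ℝ} {M : ℝ}
    (hm : ∀ v, m (w v) ≤ M) {x : Space} (hx : x ∈ convexHull ℝ (Set.range w)) (hxM : m x = M) :
    x ∈ convexHull ℝ (w '' {v | m (w v) = M}) := by
  classical
  have : w '' {v | m (w v) = M} =
      w '' ((Finset.univ.filter fun v => m (w v) = M : Finset V) : Set V) := by simp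
  rw [this, mem_convexHull_image_finset_iff]
  have huniv : Set.range w = w '' ((Finset.univ : Finset V) : Set V) := by simp
  rw [huniv, mem_convexHull_image_finset_iff] at hx
  obtain ⟨α, α0, -, α1, rfl⟩ := hx
  refine ⟨α, α0, fun v hv => ?_, α1, rfl⟩
  have h2 : ∑ v, α v * (M - m (w v)) = 0 := by
    simp only [map_sum, map_smul, smul_eq_mul] at hxM
    simp only [mul_sub, Finset.sum_sub_distrib, ← Finset.sum_mul, α1, hxM]
    ring
  have h4 := (Finset.sum_eq_zero_iff_of_nonneg fun v _ =>
    mul_nonneg (α0 v) (sub_nonneg.2 (hm v))).1 h2 v (Finset.mem_univ v)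
  refine (mul_eq_zero.1 h4).resolve_right fun h => hv ?_
  simp only [Finset.mem_filter, Finset.mem_univ, true_and]
  linarith

theorem apply_le_of_mem_convexHull {w : V → Space} {m : Space →L[ℝ] ℝ} {M : ℝ}
    (hm : ∀ v, m (w v) ≤ M) {x : Space} (hx : x ∈ convexHull ℝ (Set.range w)) : m x ≤ M := by
  refine convexHull_min (t := {x | m x ≤ M}) ?_ ?_ hx
  · rintro _ ⟨v, rfl⟩
    exact hm v
  · exact convex_halfSpace_le m.isLinear M

/-- By `exists_weights_of_apply_eq`, a functional whose maximum over the generators is strict is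
maximized on the whole hull only at that generator. Both ends of a segment through it must then
attain the maximum. -/
theorem mem_extremePoints_of_forall_lt {w : V → Space} (v : V) (m : Space →L[ℝ] ℝ)
    (hm : ∀ u, u ≠ v → m (w u) < m (w v)) :
    w v ∈ Set.extremePoints ℝ (convexHull ℝ (Set.range w)) := by
  have hle : ∀ u, m (w u) ≤ m (w v) := fun u => by
    by_cases h : u = v
    · rw [h]
    · exact (hm u h).le
  have uniq : ∀ x ∈ convexHull ℝ (Set.range w), m x = m (w v) → x = w v := by
    intro x hx hxm
    have := exists_weights_of_apply_eq hle hx hxm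
    have hs : {u | m (w u) = m (w v)} = {v} := by
      ext u
      simp only [Set.mem_ofPred_eq, Set.mem_singleton_iff]
      exact ⟨fun h => by_contra fun hu => (hm u hu).ne h, fun h => by rw [h]⟩
    rw [hs, Set.image_singleton, convexHull_singleton] at this
    exact this
  rw [mem_extremePoints]
  refine ⟨subset_convexHull ℝ _ ⟨v, rfl⟩, fun x hx y hy hxy => ?_⟩
  have hx' := apply_le_of_mem_convexHull hle hx
  have hy' := apply_le_of_mem_convexHull hle hy
  obtain ⟨a, b, ha, hb, hab, he⟩ := hxy
  have hval : a * m x + b * m y = m (w v) := by rw [← he]; simp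
  have hzero : a * (m (w v) - m x) + b * (m (w v) - m y) = 0 := by
    linear_combination m (w v) * hab - hval
  have hax := mul_nonneg ha.le (sub_nonneg.2 hx')
  have hby := mul_nonneg hb.le (sub_nonneg.2 hy')
  constructor
  · refine uniq x hx ?_
    have : a * (m (w v) - m x) = 0 := by linarith
    linarith [(mul_eq_zero.1 this).resolve_left ha.ne']
  · refine uniq y hy ?_
    have : b * (m (w v) - m y) = 0 := by linarith
    linarith [(mul_eq_zero.1 this).resolve_left hb.ne']

namespace IsConvexFan

variable {w : V → Space} {tri : ι → Fin 3 → V} {ℓ : ι → Space →L[ℝ] ℝ}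

theorem setOf_apply_eq_one (h : IsConvexFan w tri ℓ) (i : ι) :
    {v | ℓ i (w v) = 1} = Set.range (tri i) := by
  ext v
  constructor
  · intro hv
    by_contra hn
    exact (h.lt_one i v fun k hk => hn ⟨k, hk.symm⟩).ne hv
  · rintro ⟨k, rfl⟩
    exact h.eq_one i k

theorem isFacet (h : IsConvexFan w tri ℓ) (i : ι) :
    IsFacet (convexHull ℝ (Set.range w)) {x ∈ convexHull ℝ (Set.range w) | ℓ i x = 1} := by
  have hmem : ∀ k, w (tri i k) ∈ {x ∈ convexHull ℝ (Set.range w) | ℓ i x = 1} := fun k =>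
    ⟨subset_convexHull ℝ _ ⟨_, rfl⟩, h.eq_one i k⟩
  constructor
  · rintro -
    refine ⟨ℓ i, ?_⟩
    ext x
    refine and_congr_right fun hx => ⟨fun h1 y hy => h1 ▸ h.apply_le_one i hy, fun hle => ?_⟩
    exact le_antisymm (h.apply_le_one i hx) (h.eq_one i 0 ▸ hle _ (hmem 0).1)
  · have heq : {x ∈ convexHull ℝ (Set.range w) | ℓ i x = 1} =
        convexHull ℝ (Set.range fun k => w (tri i k)) := by
      apply Set.Subset.antisymm
      · rintro x ⟨hx, hx1⟩
        have := exists_weights_of_apply_eq (h.le_one i) hx hx1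
        rwa [h.setOf_apply_eq_one i, ← Set.range_comp] at this
      · refine convexHull_min (by rintro _ ⟨k, rfl⟩; exact hmem k) ?_
        exact (convex_convexHull ℝ _).inter (convex_hyperplane (ℓ i).isLinear 1)
    rw [heq, ← direction_affineSpan, affineSpan_convexHull, direction_affineSpan]
    exact (h.linearIndependent i).affineIndependent.finrank_vectorSpan (by simp)

/-- Every facet of the convex hull is one of the triangles of the fan. -/
theorem exists_of_isFacet (h : IsConvexFan w tri ℓ) {G : Set Space}
    (hG : IsFacet (convexHull ℝ (Set.range w)) G) : ∃ i, ∀ v, w v ∈ G ↔ ∃ k, tri i k = v := by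
  obtain ⟨hexp, hdim⟩ := hG
  have hne : G.Nonempty := by
    by_contra hne
    rw [Set.not_nonempty_iff_eq_empty] at hne
    rw [hne, vectorSpan_empty, finrank_bot] at hdim
    omega
  obtain ⟨m, rfl⟩ := hexp hne
  obtain ⟨z, hz, hzm⟩ := hne
  set M := m z with hM
  have hle : ∀ v, m (w v) ≤ M := fun v => hzm _ (subset_convexHull ℝ _ ⟨v, rfl⟩)
  have hGM : {x ∈ convexHull ℝ (Set.range w) | ∀ y ∈ convexHull ℝ (Set.range w), m y ≤ m x} =
      {x ∈ convexHull ℝ (Set.range w) | m x = M} := by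
    ext x
    refine and_congr_right fun hx => ⟨fun h1 => le_antisymm (hzm x hx) (h1 z hz), fun h1 y hy => ?_⟩
    rw [h1]
    exact hzm y hy
  rw [hGM] at hdim ⊢
  have hhull : {x ∈ convexHull ℝ (Set.range w) | m x = M} =
      convexHull ℝ (w '' {v | m (w v) = M}) := by
    apply Set.Subset.antisymm
    · rintro x ⟨hx, hxM⟩
      exact exists_weights_of_apply_eq hle hx hxM
    · refine convexHull_min ?_ ?_
      · rintro _ ⟨v, hv, rfl⟩
        exact ⟨subset_convexHull ℝ _ ⟨v, rfl⟩, hv⟩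
      · exact (convex_convexHull ℝ _).inter (convex_hyperplane m.isLinear M)
  rw [hhull, ← direction_affineSpan, affineSpan_convexHull, direction_affineSpan] at hdim
  obtain ⟨s, hs, hspan, hind⟩ := exists_affineIndependent ℝ Space (w '' {v | m (w v) = M})
  have hfin : s.Finite := (Set.toFinite _).subset hs
  have := hfin.fintype
  have hcard : Fintype.card s = 3 := by
    have hsne : s.Nonempty := by
      rw [← affineSpan_nonempty ℝ, hspan, affineSpan_nonempty]
      by_contra hne
      rw [Set.not_nonempty_iff_eq_empty] at hne
      rw [hne, vectorSpan_empty, finrank_bot] at hdim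
      omega
    have : Nonempty s := hsne.to_subtype
    have hpos : 0 < Fintype.card {x // x ∈ s} := Fintype.card_pos
    have h1 := hind.finrank_vectorSpan (n := Fintype.card {x // x ∈ s} - 1) (by omega)
    rw [Subtype.range_coe, ← direction_affineSpan, hspan, direction_affineSpan, hdim] at h1
    change Fintype.card {x // x ∈ s} = 3
    omega
  -- If M ≤ 0, then `m` is nonpositive on every cone, hence everywhere, hence zero. The exposed face
  -- would then be the whole three-dimensional hull.
  have hMpos : 0 < M := by
    by_contra hM0
    push Not at hM0
    have hm0 : ∀ x, m x ≤ 0 := by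
      intro x
      obtain ⟨i, μ, hμ, rfl⟩ := h.exists_cone x
      simp only [map_sum, map_smul, smul_eq_mul]
      exact Finset.sum_nonpos fun k _ =>
        mul_nonpos_of_nonneg_of_nonpos (hμ k) ((hle _).trans hM0)
    have hmz : ∀ x, m x = 0 := fun x =>
      le_antisymm (hm0 x) (by have := hm0 (-x); rw [map_neg] at this; linarith)
    have : {v | m (w v) = M} = Set.univ := by
      ext v
      simp [hM, hmz]
    rw [this, Set.image_univ, h.vectorSpan_range_eq_top, finrank_top,
      finrank_euclideanSpace_fin] at hdim
    omega
  let e : Fin 3 ≃ s := (finCongr hcard.symm).trans (Fintype.equivFin s).symm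
  have hv : ∀ k, ∃ v, m (w v) = M ∧ w v = e k := fun k => hs (e k).2
  choose v hvM hve using hv
  have hvinj : Function.Injective v := fun a b hab =>
    e.injective (Subtype.ext (by rw [← hve, ← hve, hab]))
  -- The triangle is found as the one whose cone contains the sum of three affinely independent
  -- maximizing vertices. Applying `m` gives ∑ μ ≥ 3, while ∑ μ is also the sum of three values of
  -- `ℓ i`, each at most 1. So all three vertices lie on triangle `i`.
  obtain ⟨i, μ, hμ, hx⟩ := h.exists_cone (∑ k, w (v k))
  have h3 : 3 ≤ ∑ k, μ k := by
    have h1 : m (∑ k, w (v k)) = 3 * M := by simp [map_sum, hvM]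
    have h2 : m (∑ k, μ k • w (tri i k)) ≤ (∑ k, μ k) * M := by
      simp only [map_sum, map_smul, smul_eq_mul, Finset.sum_mul]
      exact Finset.sum_le_sum fun k _ => mul_le_mul_of_nonneg_left (hle _) (hμ k)
    rw [← hx, h1] at h2
    exact le_of_mul_le_mul_right h2 hMpos
  have h4 : ∑ k, ℓ i (w (v k)) = ∑ k, μ k := by
    rw [← map_sum, hx]
    simp [h.eq_one]
  have h5 : ∀ k, ∃ l, tri i l = v k := by
    intro k
    have : ℓ i (w (v k)) = 1 := by
      have a0 := h.le_one i (v 0)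
      have a1 := h.le_one i (v 1)
      have a2 := h.le_one i (v 2)
      rw [Fin.sum_univ_three] at h4
      fin_cases k <;> simp only [Fin.zero_eta, Fin.mk_one, Fin.reduceFinMk] <;> linarith
    have hmem : v k ∈ {v | ℓ i (w v) = 1} := this
    rwa [h.setOf_apply_eq_one i] at hmem
  choose σ hσ using h5
  have hσinj : Function.Injective σ := fun a b hab => hvinj (by rw [← hσ, ← hσ, hab])
  have hml : m = M • ℓ i := by
    refine h.eq_of_apply_eq i fun l => ?_
    obtain ⟨k, rfl⟩ := Finite.surjective_of_injective hσinj l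
    rw [hσ, hvM]
    simp [← hσ, h.eq_one]
  refine ⟨i, fun u => ?_⟩
  have h6 : (∃ k, tri i k = u) ↔ u ∈ {v | ℓ i (w v) = 1} := by
    rw [h.setOf_apply_eq_one i]
    exact Iff.rfl
  rw [h6]
  have hu : w u ∈ convexHull ℝ (Set.range w) := subset_convexHull ℝ _ ⟨u, rfl⟩
  have h7 : m (w u) = M * ℓ i (w u) := by rw [hml]; rfl
  constructor
  · rintro ⟨-, huM⟩
    have : M * ℓ i (w u) = M * 1 := by rw [← h7, huM, mul_one]
    exact mul_left_cancel₀ hMpos.ne' this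
  · intro hu1
    refine ⟨hu, ?_⟩
    rw [h7, show ℓ i (w u) = 1 from hu1, mul_one]

/-- A polyhedron whose faces are the triangles of a convex fan is topologically convex. -/
theorem isTopologicallyConvex (h : IsConvexFan w tri ℓ) (P : TriPolyhedron V)
    (hfaces : ∀ S, S ∈ P.faces ↔ ∃ i, Finset.univ.image (tri i) = S)
    (hext : ∀ v, ∃ m : Space →L[ℝ] ℝ, ∀ u, u ≠ v → m (w u) < m (w v)) :
    P.IsTopologicallyConvex := by
  refine ⟨_, h.isConvexPolyhedron, ?_⟩
  have hmem : ∀ v, w v ∈ Set.extremePoints ℝ (convexHull ℝ (Set.range w)) := fun v =>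
    let ⟨m, hm⟩ := hext v
    mem_extremePoints_of_forall_lt v m hm
  refine ⟨Equiv.ofBijective (fun v => ⟨w v, hmem v⟩) ⟨fun u v huv => ?_, ?_⟩, fun S => ?_⟩
  · by_contra hne
    obtain ⟨m, hm⟩ := hext v
    exact (hm u hne).ne (congrArg m (congrArg Subtype.val huv))
  · rintro ⟨x, hx⟩
    obtain ⟨v, rfl⟩ := extremePoints_convexHull_subset hx
    exact ⟨v, rfl⟩
  · rw [hfaces]
    constructor
    · rintro ⟨i, rfl⟩
      refine ⟨_, h.isFacet i, fun v => ?_⟩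
      have h6 : v ∈ {v | ℓ i (w v) = 1} ↔ v ∈ Finset.univ.image (tri i) := by
        rw [h.setOf_apply_eq_one i]
        simp
      rw [← h6]
      exact ⟨fun hv => ⟨subset_convexHull ℝ _ ⟨v, rfl⟩, hv⟩, fun hv => hv.2⟩
    · rintro ⟨G, hG, hS⟩
      obtain ⟨i, hi⟩ := h.exists_of_isFacet hG
      refine ⟨i, ?_⟩
      ext v
      refine Iff.trans ?_ ((hS v).trans (hi v)).symm
      simp

end IsConvexFan

end Fan

/-! ### Coordinates of the spiked polyhedron and its convex model -/

section Spiked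

/-- The signs of the coordinates of the axis of the hat `h`: the four axes point to alternate
vertices of a cube. -/
def axisSign (h : Fin 4) (i : Fin 3) : ℤ := if h = 0 ∨ h = i.succ then 1 else -1

/-- The apex of the hat `h`. -/
def apexV (h : Fin 4) : Fin 20 := ⟨4 + h, by omega⟩

/-- The vertex of the brim of the hat `h` displaced in the direction of the axis `i`. -/
def brimV (h : Fin 4) (i : Fin 3) : Fin 20 := ⟨8 + 3 * h + i, by omega⟩

/-- The corner opposite to the hat `h`. -/
def cornerV (h : Fin 4) : Fin 20 := ⟨h, by omega⟩

/-- The corner of the hat `h` on the mirror plane through `brimV h i`. -/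
def hatCorner (h : Fin 4) (i : Fin 3) : Fin 20 := cornerV (h ^^^ i.succ)

/-- Integer coordinates of the vertices of the spiked polyhedron. -/
def coord (v : Fin 20) (k : Fin 3) : ℤ :=
  if v.val < 4 then -83 * axisSign (Fin.ofNat 4 v) k
  else if v.val < 8 then 153 * axisSign (Fin.ofNat 4 (v - 4)) k
  else (if (v.val - 8) % 3 = k.val then 111 else 97) * axisSign (Fin.ofNat 4 ((v - 8) / 3)) k

/-- Factors that move the vertices of the spiked polyhedron into convex position. -/
def convexScale (v : Fin 20) : ℤ := if v.val < 4 then 6 else if v.val < 8 then 2 else 3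

/-- Indices of faces: a hat, an index of a brim vertex, and one of three kinds. -/
abbrev FaceIndex : Type := Fin 4 × Fin 3 × Fin 3

/-- The vertices of the faces: spike triangles, brim triangles with an edge at the spike, and
brim triangles with an edge at the rim of the hat. -/
def faceVertex (x : FaceIndex) : Fin 3 → Fin 20 :=
  match x with
  | (h, i, 0) => ![apexV h, brimV h (i + 1), brimV h (i + 2)]
  | (h, i, 1) => ![hatCorner h i, brimV h (i + 1), brimV h (i + 2)]
  | (h, i, 2) => ![brimV h i, hatCorner h (i + 1), hatCorner h (i + 2)]

/-- The face with a given index as a set of vertices. -/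
def face (x : FaceIndex) : Finset (Fin 20) := Finset.univ.image (faceVertex x)

/-- The position of a vertex. -/
noncomputable def spikedPos (v : Fin 20) : Space := WithLp.toLp 2 fun k => (coord v k : ℝ)

/-- Integer coordinates of the vertices of the convex model. -/
def convexCoord (v : Fin 20) (k : Fin 3) : ℤ := convexScale v * coord v k

/-- Vertices of the convex model. -/
noncomputable def convexPos (v : Fin 20) : Space := WithLp.toLp 2 fun k => (convexCoord v k : ℝ)

def cross3 (a b : Fin 3 → ℤ) : Fin 3 → ℤ :=
  ![a 1 * b 2 - a 2 * b 1, a 2 * b 0 - a 0 * b 2, a 0 * b 1 - a 1 * b 0]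

def dot3 (a b : Fin 3 → ℤ) : ℤ := a 0 * b 0 + a 1 * b 1 + a 2 * b 2

/-- A normal vector of a face of the convex model. -/
def faceNormal (x : FaceIndex) : Fin 3 → ℤ :=
  cross3 (convexCoord (faceVertex x 1) - convexCoord (faceVertex x 0))
    (convexCoord (faceVertex x 2) - convexCoord (faceVertex x 0))

def faceOffset (x : FaceIndex) : ℤ := dot3 (faceNormal x) (convexCoord (faceVertex x 0))

noncomputable def faceFunctional (x : FaceIndex) : Space →L[ℝ] ℝ :=
  ∑ k, ((faceNormal x k : ℝ) / faceOffset x) • EuclideanSpace.proj k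

theorem faceFunctional_convexPos (x : FaceIndex) (v : Fin 20) :
    faceFunctional x (convexPos v) =
      (dot3 (faceNormal x) (convexCoord v) : ℤ) / (faceOffset x : ℝ) := by
  simp [faceFunctional, convexPos, Fin.sum_univ_three, dot3]
  ring

theorem faceOffset_ne_zero : ∀ x, faceOffset x ≠ 0 := by decide +kernel

theorem dot3_faceNormal_vertex :
    ∀ x k, dot3 (faceNormal x) (convexCoord (faceVertex x k)) = faceOffset x := by
  decide +kernel

/-- The factor `faceOffset x` on both sides makes the inequality independent of the sign of the
offset, which depends on the order in which `faceVertex` lists the vertices. -/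
theorem dot3_faceNormal_lt : ∀ x v, (∀ k, v ≠ faceVertex x k) →
    faceOffset x * dot3 (faceNormal x) (convexCoord v) < faceOffset x * faceOffset x := by
  decide +kernel

theorem exists_adjacent_face : ∀ x k, ∃ y, (∀ k', k' ≠ k → ∃ l, faceVertex x k' = faceVertex y l) ∧
    ∀ l, faceVertex x k ≠ faceVertex y l := by
  decide +kernel

/-- Each vertex of the convex model is exposed by its own position vector, hence is an extreme
point. -/
theorem dot3_convexCoord_lt : ∀ v u, u ≠ v →
    dot3 (convexCoord v) (convexCoord u) < dot3 (convexCoord v) (convexCoord v) := by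
  decide +kernel

theorem linearIndependent_of_dot3_cross3_ne_zero (a b c : Fin 3 → ℤ)
    (h : dot3 (cross3 b c) a ≠ 0) {u : Fin 3 → Space}
    (ha : ∀ k, u 0 k = a k) (hb : ∀ k, u 1 k = b k) (hc : ∀ k, u 2 k = c k) :
    LinearIndependent ℝ u := by
  have hdet : (Matrix.of fun i j => u i j).det ≠ 0 := by
    rw [Matrix.det_fin_three]
    simp only [Matrix.of_apply, ha, hb, hc]
    intro h0
    apply h
    have : ((dot3 (cross3 b c) a : ℤ) : ℝ) = 0 := by
      simp [dot3, cross3]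
      linear_combination h0
    exact_mod_cast this
  have h1 := Matrix.linearIndependent_rows_of_det_ne_zero hdet
  exact LinearIndependent.of_comp (WithLp.linearEquiv 2 ℝ (Fin 3 → ℝ)).toLinearMap h1

theorem dot3_convexCoord_vertices : ∀ x, dot3 (cross3 (convexCoord (faceVertex x 1))
    (convexCoord (faceVertex x 2))) (convexCoord (faceVertex x 0)) ≠ 0 := by
  decide +kernel

theorem isConvexFan : IsConvexFan convexPos faceVertex faceFunctional where
  nonempty := inferInstance
  eq_one x k := by
    rw [faceFunctional_convexPos, dot3_faceNormal_vertex]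
    exact div_self (Int.cast_ne_zero.2 (faceOffset_ne_zero x))
  lt_one x v hv := by
    rw [faceFunctional_convexPos]
    have h0 : (faceOffset x : ℝ) ≠ 0 := Int.cast_ne_zero.2 (faceOffset_ne_zero x)
    have h1 : (faceOffset x : ℝ) * (dot3 (faceNormal x) (convexCoord v) : ℤ) <
        faceOffset x * faceOffset x := by exact_mod_cast dot3_faceNormal_lt x v hv
    have h2 : 0 < (faceOffset x : ℝ) * faceOffset x := mul_self_pos.2 h0
    rw [← mul_div_mul_left _ _ h0, div_lt_one h2]
    exact h1
  linearIndependent x :=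
    linearIndependent_of_dot3_cross3_ne_zero _ _ _ (dot3_convexCoord_vertices x)
      (fun _ => rfl) (fun _ => rfl) (fun _ => rfl)
  exists_neighbor := exists_adjacent_face

theorem exists_functional_lt (v : Fin 20) :
    ∃ m : Space →L[ℝ] ℝ, ∀ u, u ≠ v → m (convexPos u) < m (convexPos v) := by
  have heval : ∀ u, (∑ k, (convexCoord v k : ℝ) • EuclideanSpace.proj k : Space →L[ℝ] ℝ)
      (convexPos u) = (dot3 (convexCoord v) (convexCoord u) : ℤ) := by
    intro u
    simp [convexPos, Fin.sum_univ_three, dot3]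
  refine ⟨∑ k, (convexCoord v k : ℝ) • EuclideanSpace.proj k, fun u hu => ?_⟩
  rw [heval, heval]
  exact_mod_cast dot3_convexCoord_lt v u hu

end Spiked

/-! ### The spiked polyhedron as a surface with acute isosceles faces -/

section Spiked

theorem isChain_reflTransGen {α : Type} {r : α → α → Prop} (hr : ∀ a b, r a b → r b a)
    {l : List α} (hl : l.IsChain r) {a b : α} (ha : a ∈ l) (hb : b ∈ l) :
    Relation.ReflTransGen r a b := by
  induction l generalizing a b with
  | nil => simp at ha
  | cons c l ih =>
    have hsymm : ∀ {x y}, Relation.ReflTransGen r x y → Relation.ReflTransGen r y x :=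
      fun h => Relation.reflTransGen_swap.1 (Relation.ReflTransGen.mono (fun x y => hr x y) _ _ h)
    have hl' : l.IsChain r := hl.tail
    have hc : ∀ {x}, x ∈ l → Relation.ReflTransGen r c x := by
      intro x hx
      cases l with
      | nil => simp at hx
      | cons d l =>
        have hcd : r c d := by simp at hl; exact hl.1
        exact (Relation.ReflTransGen.single hcd).trans (ih hl' (by simp) hx)
    rcases List.mem_cons.1 ha with hac | hal <;> rcases List.mem_cons.1 hb with hbc | hbl
    · rw [hac, hbc]
    · rw [hac]
      exact hc hbl
    · rw [hbc]
      exact hsymm (hc hal)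
    · exact ih hl' hal hbl

/-- The faces of the spiked polyhedron. -/
def spikedFaces : Finset (Finset (Fin 20)) := Finset.univ.image face

theorem mem_spikedFaces {f : Finset (Fin 20)} : f ∈ spikedFaces ↔ ∃ x, face x = f := by
  simp [spikedFaces]

/-- The faces around a vertex in cyclic order. -/
def faceStar (v : Fin 20) : List FaceIndex :=
  if v.val < 4 then
    let g : Fin 4 := Fin.ofNat 4 v
    [(g ^^^ 1, 1, 2), (g ^^^ 1, 0, 1), (g ^^^ 1, 2, 2), (g ^^^ 2, 2, 2), (g ^^^ 2, 1, 1),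
      (g ^^^ 2, 0, 2), (g ^^^ 3, 0, 2), (g ^^^ 3, 2, 1), (g ^^^ 3, 1, 2)]
  else if v.val < 8 then
    let h : Fin 4 := Fin.ofNat 4 (v - 4)
    [(h, 0, 0), (h, 1, 0), (h, 2, 0)]
  else
    let h : Fin 4 := Fin.ofNat 4 ((v - 8) / 3)
    let i : Fin 3 := Fin.ofNat 3 (v - 8)
    [(h, i + 2, 0), (h, i + 1, 0), (h, i + 1, 1), (h, i, 2), (h, i + 2, 1)]

theorem isChain_faceStar : ∀ v, (faceStar v).IsChain
    (fun x y => v ∈ face x ∩ face y ∧ (face x ∩ face y).card = 2) := by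
  decide +kernel

theorem mem_faceStar : ∀ v x, v ∈ face x → x ∈ faceStar v := by decide +kernel

/-- A walk across edges through all faces. -/
def faceWalk : List FaceIndex :=
  let walk (h : Fin 4) : List FaceIndex :=
    [(h, 0, 2), (h, 1, 1), (h, 2, 2), (h, 0, 1), (h, 1, 2), (h, 2, 1), (h, 2, 0), (h, 1, 0),
      (h, 0, 0), (h, 0, 1), (h, 1, 2)]
  -- The walk of hat `h` starts at `(h, 0, 2)` and ends at `(h, 1, 2)`. The rim edges of these faces
  -- lead to the hats `h ^^^ 1` and `h ^^^ 2`, so alternately reversed walks fit together.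
  walk 0 ++ (walk 2).reverse ++ walk 3 ++ (walk 1).reverse

theorem isChain_faceWalk : faceWalk.IsChain (fun x y => (face x ∩ face y).card = 2) := by
  decide +kernel

theorem mem_faceWalk : ∀ x, x ∈ faceWalk := by decide +kernel

theorem card_face : ∀ x, (face x).card = 3 := by decide +kernel

theorem face_injective : ∀ x y, face x = face y → x = y := by decide +kernel

theorem card_filter_pair : ∀ x, ∀ k l, k ≠ l →
    (Finset.univ.filter fun y => faceVertex x k ∈ face y ∧ faceVertex x l ∈ face y).card = 2 := by
  decide +kernel

theorem card_filter_edge (x : FaceIndex) (e : Finset (Fin 20)) (he : e ⊆ face x)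
    (hcard : e.card = 2) : (spikedFaces.filter (fun g => e ⊆ g)).card = 2 := by
  obtain ⟨a, b, hab, rfl⟩ := Finset.card_eq_two.1 hcard
  obtain ⟨k, -, rfl⟩ := Finset.mem_image.1 (he (Finset.mem_insert_self a _))
  obtain ⟨l, -, rfl⟩ := Finset.mem_image.1 (he (Finset.mem_insert_of_mem (Finset.mem_singleton_self b)))
  rw [spikedFaces, Finset.filter_image, Finset.card_image_of_injective _ fun x y => face_injective x y]
  rw [← card_filter_pair x k l fun h => hab (by rw [h])]
  simp [Finset.insert_subset_iff]

theorem exists_mem_face : ∀ v, ∃ x, v ∈ face x := by decide +kernel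

theorem dot3_coord_vertices : ∀ x, dot3 (cross3 (coord (faceVertex x 1))
    (coord (faceVertex x 2))) (coord (faceVertex x 0)) ≠ 0 := by
  decide +kernel

/-- The determinant is a tetrahedron's volume up to a factor; that it does not vanish shows adjacent
faces are not coplanar. -/
theorem exists_tetrahedron : ∀ x y, (face x ∩ face y).card = 2 → ∃ v ∈ face y,
    dot3 (cross3 (coord (faceVertex x 1) - coord v) (coord (faceVertex x 2) - coord v))
      (coord (faceVertex x 0) - coord v) ≠ 0 := by
  decide +kernel

theorem linearIndependent_spikedPos (x : FaceIndex) :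
    LinearIndependent ℝ fun k => spikedPos (faceVertex x k) :=
  linearIndependent_of_dot3_cross3_ne_zero _ _ _ (dot3_coord_vertices x)
      (fun _ => rfl) (fun _ => rfl) (fun _ => rfl)

theorem affineIndependent_face (x : FaceIndex) :
    AffineIndependent ℝ (fun v : face x => spikedPos v) := by
  have hv : ∀ v : face x, ∃ k, faceVertex x k = v := fun v => by
    obtain ⟨k, -, hk⟩ := Finset.mem_image.1 v.2
    exact ⟨k, hk⟩
  choose σ hσ using hv
  have hinj : Function.Injective σ := fun u v huv => Subtype.ext (by rw [← hσ, ← hσ, huv])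
  have := ((linearIndependent_spikedPos x).comp σ hinj).affineIndependent
  simpa [Function.comp_def, hσ] using this

theorem not_coplanar_faces (x y : FaceIndex) (hxy : (face x ∩ face y).card = 2) :
    ¬ Coplanar ℝ (spikedPos '' ((face x ∪ face y : Finset (Fin 20)) : Set (Fin 20))) := by
  intro hc
  have h2 := hc.finrank_le_two
  obtain ⟨v, hv, hdet⟩ := exists_tetrahedron x y hxy
  have hli := linearIndependent_of_dot3_cross3_ne_zero _ _ _ hdet
    (u := fun k => spikedPos (faceVertex x k) - spikedPos v)
    (fun k => by simp [spikedPos]) (fun k => by simp [spikedPos]) (fun k => by simp [spikedPos])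
  have htop : vectorSpan ℝ (spikedPos '' ((face x ∪ face y : Finset (Fin 20)) : Set (Fin 20)))
      = ⊤ := by
    rw [eq_top_iff, ← hli.span_eq_top_of_card_eq_finrank' (by simp), Submodule.span_le]
    rintro _ ⟨k, rfl⟩
    refine vsub_mem_vectorSpan ℝ ⟨_, ?_, rfl⟩ ⟨_, ?_, rfl⟩
    · exact Finset.mem_coe.2 (Finset.mem_union_left _
        (Finset.mem_image.2 ⟨k, Finset.mem_univ _, rfl⟩))
    · exact Finset.mem_coe.2 (Finset.mem_union_right _ hv)
  rw [htop, finrank_top, finrank_euclideanSpace_fin] at h2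
  omega

theorem convexPos_eq (v : Fin 20) : convexPos v = (convexScale v : ℝ) • spikedPos v := by
  ext k
  simp [convexPos, spikedPos, convexCoord]

theorem convexScale_pos : ∀ v, 0 < convexScale v := by decide +kernel

/-- The spiked polyhedron: a cube of which four alternate vertices carry a sharp spike. -/
noncomputable def spiked : TriPolyhedron (Fin 20) where
  pos := spikedPos
  faces := spikedFaces
  nonempty := ⟨face (0, 0, 0), mem_spikedFaces.2 ⟨_, rfl⟩⟩
  card_face f hf := by
    obtain ⟨x, rfl⟩ := mem_spikedFaces.1 hf
    exact card_face x
  exists_face v := by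
    obtain ⟨x, hx⟩ := exists_mem_face v
    exact ⟨_, mem_spikedFaces.2 ⟨x, rfl⟩, hx⟩
  nondegenerate f hf := by
    obtain ⟨x, rfl⟩ := mem_spikedFaces.1 hf
    exact affineIndependent_face x
  embedded f hf g hg := by
    obtain ⟨x, rfl⟩ := mem_spikedFaces.1 hf
    obtain ⟨y, rfl⟩ := mem_spikedFaces.1 hg
    -- The scaling to the convex model is radial with positive factors, so disjointness of the cones
    -- transfers.
    exact isConvexFan.convexHull_inter_subset
      (fun v => Int.cast_pos.2 (convexScale_pos v)) convexPos_eq x y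
  closed f hf e he hcard := by
    obtain ⟨x, rfl⟩ := mem_spikedFaces.1 hf
    exact card_filter_edge x e he hcard
  link_connected v f hf g hg hvf hvg := by
    obtain ⟨x, rfl⟩ := mem_spikedFaces.1 hf
    obtain ⟨y, rfl⟩ := mem_spikedFaces.1 hg
    refine Relation.ReflTransGen.lift face ?_ _ _ (isChain_reflTransGen ?_ (isChain_faceStar v)
      (mem_faceStar v x hvf) (mem_faceStar v y hvg))
    · exact fun x y h => ⟨mem_spikedFaces.2 ⟨x, rfl⟩, mem_spikedFaces.2 ⟨y, rfl⟩, h⟩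
    · exact fun x y h => by rwa [Finset.inter_comm]
  connected f hf g hg := by
    obtain ⟨x, rfl⟩ := mem_spikedFaces.1 hf
    obtain ⟨y, rfl⟩ := mem_spikedFaces.1 hg
    refine Relation.ReflTransGen.lift face ?_ _ _ (isChain_reflTransGen ?_ isChain_faceWalk
      (mem_faceWalk x) (mem_faceWalk y))
    · exact fun x y h => ⟨mem_spikedFaces.2 ⟨x, rfl⟩, mem_spikedFaces.2 ⟨y, rfl⟩, h⟩
    · exact fun x y h => by rwa [Finset.inter_comm]
  not_coplanar f hf g hg hfg := by
    obtain ⟨x, rfl⟩ := mem_spikedFaces.1 hf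
    obtain ⟨y, rfl⟩ := mem_spikedFaces.1 hg
    exact not_coplanar_faces x y hfg

theorem spiked_isTopologicallyConvex : spiked.IsTopologicallyConvex :=
  isConvexFan.isTopologicallyConvex spiked (fun _ => mem_spikedFaces) exists_functional_lt

/-- Squared distance of two vertices. -/
def sqDist (u v : Fin 20) : ℤ := dot3 (coord u - coord v) (coord u - coord v)

theorem dist_spikedPos_sq (u v : Fin 20) : dist (spikedPos u) (spikedPos v) ^ 2 = sqDist u v := by
  rw [EuclideanSpace.dist_eq, Real.sq_sqrt (by positivity)]
  simp [Fin.sum_univ_three, spikedPos, Real.dist_eq, sqDist, dot3, sq_abs]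
  ring

theorem dot3_acute : ∀ x, ∀ a ∈ face x, ∀ b ∈ face x, ∀ c ∈ face x, a ≠ b → b ≠ c → a ≠ c →
    0 < dot3 (coord a - coord b) (coord c - coord b) := by
  decide +kernel

theorem spiked_isAcuteFace (x : FaceIndex) : spiked.IsAcuteFace (face x) := by
  intro a ha b hb c hc hab hbc hac
  have h := dot3_acute x a ha b hb c hc hab hbc hac
  have hin : 0 < inner ℝ (spikedPos a -ᵥ spikedPos b) (spikedPos c -ᵥ spikedPos b) := by
    have : inner ℝ (spikedPos a -ᵥ spikedPos b) (spikedPos c -ᵥ spikedPos b) =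
        (dot3 (coord a - coord b) (coord c - coord b) : ℤ) := by
      simp [PiLp.inner_apply, Fin.sum_univ_three, spikedPos, dot3]
      ring
    rw [this]
    exact_mod_cast h
  change InnerProductGeometry.angle _ _ < _
  rw [InnerProductGeometry.angle, Real.arccos_lt_pi_div_two]
  have hne : spikedPos a -ᵥ spikedPos b ≠ 0 := by
    intro h0; rw [h0, inner_zero_left] at hin; exact lt_irrefl _ hin
  have hne' : spikedPos c -ᵥ spikedPos b ≠ 0 := by
    intro h0; rw [h0, inner_zero_right] at hin; exact lt_irrefl _ hin
  exact div_pos hin (mul_pos (norm_pos_iff.2 hne) (norm_pos_iff.2 hne'))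

theorem exists_sqDist_eq : ∀ x, ∃ a ∈ face x, ∃ b ∈ face x, ∃ c ∈ face x,
    a ≠ b ∧ b ≠ c ∧ a ≠ c ∧ sqDist a b = sqDist a c := by
  decide +kernel

theorem spiked_isIsoscelesFace (x : FaceIndex) : spiked.IsIsoscelesFace (face x) := by
  obtain ⟨a, ha, b, hb, c, hc, hab, hbc, hac, h⟩ := exists_sqDist_eq x
  refine ⟨a, ha, b, hb, c, hc, hab, hbc, hac, ?_⟩
  change dist (spikedPos a) (spikedPos b) = dist (spikedPos a) (spikedPos c)
  rw [← sq_eq_sq₀ dist_nonneg dist_nonneg, dist_spikedPos_sq, dist_spikedPos_sq, h]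

end Spiked

/-! ### Plane triangles in a frame, and when they overlap -/

section Planar

/-- Twice the signed area of a triangle. -/
def cross (p q r : Plane) : ℝ := (q 0 - p 0) * (r 1 - p 1) - (q 1 - p 1) * (r 0 - p 0)

/-- The image of `x + i y` under the similarity that maps `0` to `p` and `1` to `q`; it preserves
the orientation if `s = 1` and reverses it if `s = -1`. -/
def turn (s : ℝ) (p q : Plane) (x y : ℝ) : Plane :=
  !₂[p 0 + x * (q 0 - p 0) - s * y * (q 1 - p 1), p 1 + x * (q 1 - p 1) + s * y * (q 0 - p 0)]

@[simp] theorem turn_apply_zero (s : ℝ) (p q : Plane) (x y : ℝ) :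
    turn s p q x y 0 = p 0 + x * (q 0 - p 0) - s * y * (q 1 - p 1) := rfl

@[simp] theorem turn_apply_one (s : ℝ) (p q : Plane) (x y : ℝ) :
    turn s p q x y 1 = p 1 + x * (q 1 - p 1) + s * y * (q 0 - p 0) := rfl

theorem Plane.ext {p q : Plane} (h0 : p 0 = q 0) (h1 : p 1 = q 1) : p = q := by
  ext k
  fin_cases k
  exacts [h0, h1]

theorem turn_origin (s : ℝ) (p q : Plane) : turn s p q 0 0 = p :=
  Plane.ext (by simp) (by simp)

theorem turn_unit (s : ℝ) (p q : Plane) : turn s p q 1 0 = q :=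
  Plane.ext (by simp) (by simp)

theorem turn_turn {s : ℝ} (hs : s * s = 1) (p q : Plane) (x₀ y₀ x₁ y₁ x y : ℝ) :
    turn s (turn s p q x₀ y₀) (turn s p q x₁ y₁) x y =
      turn s p q (x₀ + x * (x₁ - x₀) - y * (y₁ - y₀)) (y₀ + x * (y₁ - y₀) + y * (x₁ - x₀)) := by
  apply Plane.ext
  · simp only [turn_apply_zero, turn_apply_one]
    linear_combination (-(y * (y₁ - y₀) * (q 0 - p 0))) * hs
  · simp only [turn_apply_zero, turn_apply_one]
    linear_combination (-(y * (y₁ - y₀) * (q 1 - p 1))) * hs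

theorem dist_sq_plane (p q : Plane) : dist p q ^ 2 = (q 0 - p 0) ^ 2 + (q 1 - p 1) ^ 2 := by
  rw [EuclideanSpace.dist_eq, Real.sq_sqrt (by positivity)]
  simp [Fin.sum_univ_two, Real.dist_eq, sq_abs]
  ring

/-- Twice the signed area of a triangle with the given coordinates. -/
def orient (x₀ y₀ x₁ y₁ x₂ y₂ : ℝ) : ℝ := (x₁ - x₀) * (y₂ - y₀) - (y₁ - y₀) * (x₂ - x₀)

theorem cross_turn {s : ℝ} (hs : s * s = 1) (p q : Plane) (x₀ y₀ x₁ y₁ x₂ y₂ : ℝ) :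
    s * cross (turn s p q x₀ y₀) (turn s p q x₁ y₁) (turn s p q x₂ y₂) =
      dist p q ^ 2 * orient x₀ y₀ x₁ y₁ x₂ y₂ := by
  simp only [cross, turn_apply_zero, turn_apply_one, orient, dist_sq_plane]
  linear_combination (((q 0 - p 0) ^ 2 + (q 1 - p 1) ^ 2) *
    ((x₁ - x₀) * (y₂ - y₀) - (y₁ - y₀) * (x₂ - x₀))) * hs

/-- The three side lengths determine `x` by the law of cosines and `y` up to sign. The remaining
choice of a reflection is recorded by `s`, read off from the signed area. -/
theorem exists_turn_eq {p q r : Plane} {A B C x y : ℝ} (hpq : dist p q ^ 2 = A)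
    (hpr : dist p r ^ 2 = B) (hqr : dist q r ^ 2 = C) (hA : 0 < A) (hx : 2 * A * x = A + B - C)
    (hxy : A * (x ^ 2 + y ^ 2) = B) (hy : y ≠ 0) : ∃ s, s * s = 1 ∧ r = turn s p q x y := by
  rw [dist_sq_plane] at hpq hpr hqr
  have hdot : (q 0 - p 0) * (r 0 - p 0) + (q 1 - p 1) * (r 1 - p 1) = A * x := by
    linear_combination (hpq + hpr - hqr - hx) / 2
  have hcross : cross p q r ^ 2 = (A * y) ^ 2 := by
    have : cross p q r ^ 2 + ((q 0 - p 0) * (r 0 - p 0) + (q 1 - p 1) * (r 1 - p 1)) ^ 2 =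
        ((q 0 - p 0) ^ 2 + (q 1 - p 1) ^ 2) * ((r 0 - p 0) ^ 2 + (r 1 - p 1) ^ 2) := by
      rw [cross]; ring
    rw [hdot, hpq, hpr] at this
    linear_combination this - A * hxy
  have hAy : A * y ≠ 0 := mul_ne_zero hA.ne' hy
  have hsy : cross p q r / (A * y) * y = cross p q r / A := by field_simp
  refine ⟨cross p q r / (A * y), ?_, Plane.ext ?_ ?_⟩
  · rw [div_mul_div_comm, ← sq, hcross, ← sq]
    exact div_self (pow_ne_zero 2 hAy)
  · rw [turn_apply_zero, hsy]
    apply mul_left_cancel₀ hA.ne'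
    have : A * (p 0 + x * (q 0 - p 0) - cross p q r / A * (q 1 - p 1)) =
        A * p 0 + A * x * (q 0 - p 0) - cross p q r * (q 1 - p 1) := by field_simp
    rw [this, ← hdot, cross]
    linear_combination (p 0 - r 0) * hpq
  · rw [turn_apply_one, hsy]
    apply mul_left_cancel₀ hA.ne'
    have : A * (p 1 + x * (q 1 - p 1) + cross p q r / A * (q 0 - p 0)) =
        A * p 1 + A * x * (q 1 - p 1) + cross p q r * (q 0 - p 0) := by field_simp
    rw [this, ← hdot, cross]
    linear_combination (p 1 - r 1) * hpq

/-- The three signed areas, divided by their sum, are the barycentric coordinates of `m`. Their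
positivity is an open condition. -/
theorem mem_interior_convexHull {s : ℝ} {p q r m : Plane} {S : Set Plane} (hp : p ∈ S)
    (hq : q ∈ S) (hr : r ∈ S) (h₁ : 0 < s * cross p q m) (h₂ : 0 < s * cross q r m)
    (h₃ : 0 < s * cross r p m) : m ∈ interior (convexHull ℝ S) := by
  have hop : ∀ a b, IsOpen {m : Plane | 0 < s * cross a b m} := by
    intro a b
    simp only [cross]
    exact isOpen_lt continuous_const (by fun_prop)
  have hopen : IsOpen {m : Plane | 0 < s * cross p q m ∧ 0 < s * cross q r m ∧
      0 < s * cross r p m} := (hop p q).inter ((hop q r).inter (hop r p))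
  refine interior_maximal ?_ hopen ⟨h₁, h₂, h₃⟩
  rintro m ⟨h₁, h₂, h₃⟩
  set D := s * cross p q m + s * cross q r m + s * cross r p m with hD
  have hD0 : 0 < D := by positivity
  have hDc : D = s * cross p q r := by rw [hD]; simp only [cross]; ring
  refine mem_convexHull_of_exists_fintype
    ![s * cross q r m / D, s * cross r p m / D, s * cross p q m / D] ![p, q, r] ?_ ?_ ?_ ?_
  · intro k
    fin_cases k <;> simp <;> positivity
  · simp only [Fin.sum_univ_three, Matrix.cons_val_zero, Matrix.cons_val_one, Matrix.cons_val]
    rw [← add_div, ← add_div, div_eq_one_iff_eq hD0.ne', hD]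
    ring
  · intro k
    fin_cases k <;> simp [hp, hq, hr]
  · simp only [Fin.sum_univ_three, Matrix.cons_val_zero, Matrix.cons_val_one, Matrix.cons_val]
    apply Plane.ext
    · simp only [PiLp.add_apply, PiLp.smul_apply, smul_eq_mul]
      rw [div_mul_eq_mul_div, div_mul_eq_mul_div, div_mul_eq_mul_div, ← add_div, ← add_div,
        div_eq_iff hD0.ne', hDc]
      simp only [cross]
      ring
    · simp only [PiLp.add_apply, PiLp.smul_apply, smul_eq_mul]
      rw [div_mul_eq_mul_div, div_mul_eq_mul_div, div_mul_eq_mul_div, ← add_div, ← add_div,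
        div_eq_iff hD0.ne', hDc]
      simp only [cross]
      ring

theorem exists_pos_forall_pos {c₁ c₂ c₃ c₄ : ℝ} (k₁ k₂ k₃ k₄ : ℝ) (h₁ : 0 < c₁) (h₂ : 0 < c₂)
    (h₃ : 0 < c₃) (h₄ : 0 < c₄) :
    ∃ η > 0, 0 < c₁ + η * k₁ ∧ 0 < c₂ + η * k₂ ∧ 0 < c₃ + η * k₃ ∧ 0 < c₄ + η * k₄ := by
  have key : ∀ {c : ℝ} (k : ℝ), 0 < c → ∀ᶠ η in nhdsWithin (0 : ℝ) (Set.Ioi 0), 0 < c + η * k := by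
    intro c k hc
    have hcont : ContinuousAt (fun η : ℝ => c + η * k) 0 := by fun_prop
    have := hcont.eventually (lt_mem_nhds (a := 0) (by simpa using hc))
    exact this.filter_mono nhdsWithin_le_nhds
  have hpos : ∀ᶠ η in nhdsWithin (0 : ℝ) (Set.Ioi 0), η ∈ Set.Ioi (0 : ℝ) := self_mem_nhdsWithin
  obtain ⟨η, hη, a, b, c, d⟩ := (hpos.and ((key k₁ h₁).and ((key k₂ h₂).and
    ((key k₃ h₃).and (key k₄ h₄))))).exists
  exact ⟨η, hη, a, b, c, d⟩

/-- Triangles on the same side of a common edge overlap. -/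
theorem exists_mem_interior_of_same_side {s : ℝ} {p q r t : Plane} {S T : Set Plane}
    (hp : p ∈ S) (hq : q ∈ S) (hr : r ∈ S) (hp' : p ∈ T) (hq' : q ∈ T) (ht : t ∈ T)
    (h₁ : 0 < s * cross p q r) (h₂ : 0 < s * cross p q t) :
    ∃ m, m ∈ interior (convexHull ℝ S) ∧ m ∈ interior (convexHull ℝ T) := by
  let f : Plane → Plane → Plane → ℝ := fun a b c =>
    s * (s * ((b 0 - a 0) * (q 0 - p 0) + (b 1 - a 1) * (q 1 - p 1)))
  obtain ⟨η, hη, e₁, e₂, e₃, e₄⟩ := exists_pos_forall_pos (f q r p) (f r p p) (f q t p) (f t p p)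
    (half_pos h₁) (half_pos h₁) (half_pos h₂) (half_pos h₂)
  -- The midpoint of the common edge, pushed slightly to the side of `r` and `t`. At the midpoint
  -- the areas over the other sides are half those of the triangles; `f` is the rate at which they
  -- change with `η`.
  let m : Plane := turn s p q (1 / 2) η
  have hpq : 0 < s * cross p q m := by
    have : s * cross p q m = η * ((s * (q 0 - p 0)) ^ 2 + (s * (q 1 - p 1)) ^ 2) := by
      simp only [cross, m, turn_apply_zero, turn_apply_one]; ring
    rw [this]
    refine mul_pos hη ?_
    by_contra hn
    have h0 : s * (q 0 - p 0) = 0 := by nlinarith [sq_nonneg (s * (q 0 - p 0)), sq_nonneg (s * (q 1 - p 1))]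
    have h1 : s * (q 1 - p 1) = 0 := by nlinarith [sq_nonneg (s * (q 0 - p 0)), sq_nonneg (s * (q 1 - p 1))]
    have : s * cross p q r = s * (q 0 - p 0) * (r 1 - p 1) - s * (q 1 - p 1) * (r 0 - p 0) := by
      rw [cross]; ring
    rw [h0, h1] at this
    linarith
  have h3 : ∀ c, s * cross q c m = s * cross p q c / 2 + η * f q c p := by
    intro c; simp only [cross, m, turn_apply_zero, turn_apply_one, f]; ring
  have h4 : ∀ c, s * cross c p m = s * cross p q c / 2 + η * f c p p := by
    intro c; simp only [cross, m, turn_apply_zero, turn_apply_one, f]; ring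
  exact ⟨m, mem_interior_convexHull hp hq hr hpq (by rwa [h3]) (by rwa [h4]),
    mem_interior_convexHull hp' hq' ht hpq (by rwa [h3]) (by rwa [h4])⟩

end Planar

/-! ### Laying out the faces of an unfolding one after another -/

namespace TriPolyhedron.EdgeUnfolding

variable {V : Type} [Fintype V] [DecidableEq V] {P : TriPolyhedron V} (U : P.EdgeUnfolding)

/-- The position of the vertex `v` of the face `f` has the coordinates `x` and `y` in the frame
with origin `O`, unit point `I` and orientation `s`. -/
def Placed (s : ℝ) (O I : Plane) (f : Finset V) (v : V) (x y : ℝ) : Prop :=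
  U.place f v = turn s O I x y

variable {U}

theorem dist_place_sq {f : Finset V} (hf : f ∈ P.faces) {u v : V} (hu : u ∈ f) (hv : v ∈ f) :
    dist (U.place f u) (U.place f v) ^ 2 = dist (P.pos u) (P.pos v) ^ 2 := by
  rw [U.congruent f hf u hu v hv]

/-- Laying out the next face around a vertex. -/
theorem Placed.next {s : ℝ} {O I : Plane} {f g : Finset V} {p q r t : V}
    {xp yp xq yq xr yr : ℝ} (hs : s * s = 1) (hOI : 0 < dist O I)
    (hp : U.Placed s O I f p xp yp) (hq : U.Placed s O I f q xq yq)
    (hr : U.Placed s O I f r xr yr) (hor : 0 < orient xp yp xq yq xr yr)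
    (hfg : P.Joined U.cut f g) (hpf : p ∈ f) (hqf : q ∈ f) (hrf : r ∈ f) (hpg : p ∈ g)
    (hrg : r ∈ g) (htg : t ∈ g) {A B C x y : ℝ} (hA : dist (P.pos p) (P.pos r) ^ 2 = A)
    (hB : dist (P.pos p) (P.pos t) ^ 2 = B) (hC : dist (P.pos r) (P.pos t) ^ 2 = C) (hA0 : 0 < A)
    (hx : 2 * A * x = A + B - C) (hxy : A * (x ^ 2 + y ^ 2) = B) (hy : 0 < y) (xt yt : ℝ)
    (hxt : xt = xp + x * (xr - xp) - y * (yr - yp))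
    (hyt : yt = yp + x * (yr - yp) + y * (xr - xp)) :
    U.Placed s O I g p xp yp ∧ U.Placed s O I g r xr yr ∧ U.Placed s O I g t xt yt := by
  have hpp := U.attached f g hfg p (Finset.mem_inter.2 ⟨hpf, hpg⟩)
  have hrr := U.attached f g hfg r (Finset.mem_inter.2 ⟨hrf, hrg⟩)
  obtain ⟨hf, hg, hcard, -⟩ := hfg
  have hne : f ≠ g := by
    rintro rfl
    rw [Finset.inter_self, P.card_face f hf] at hcard
    omega
  unfold Placed at *
  refine ⟨hpp ▸ hp, hrr ▸ hr, ?_⟩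
  obtain ⟨s', hs', ht⟩ := exists_turn_eq (p := U.place g p) (q := U.place g r) (r := U.place g t)
    ((dist_place_sq hg hpg hrg).trans hA) ((dist_place_sq hg hpg htg).trans hB)
    ((dist_place_sq hg hrg htg).trans hC) hA0 hx hxy hy.ne'
  have hss : s' = s ∨ s' = -s := by
    have : (s' - s) * (s' + s) = 0 := by linear_combination hs' - hs
    rcases mul_eq_zero.1 this with h | h
    · exact Or.inl (by linarith)
    · exact Or.inr (by linarith)
  -- With equal orientation, `t` lands at the computed place. With the opposite one, `t` is on the
  -- same side of the common edge as `q`, and the two faces overlap.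
  rcases hss with rfl | rfl
  · rw [ht, ← hpp, ← hrr, hp, hr, turn_turn hs, hxt, hyt]
  · exfalso
    have h1 : 0 < -s * cross (U.place f p) (U.place f r) (U.place f q) := by
      have := cross_turn hs O I xp yp xq yq xr yr
      rw [← hp, ← hq, ← hr] at this
      have h2 : -s * cross (U.place f p) (U.place f r) (U.place f q) =
        s * cross (U.place f p) (U.place f q) (U.place f r) := by simp only [cross]; ring
      rw [h2, this]
      positivity
    have h2 : 0 < -s * cross (U.place f p) (U.place f r) (U.place g t) := by
      have := cross_turn hs' (U.place g p) (U.place g r) 0 0 1 0 x y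
      rw [turn_origin, turn_unit, ← ht, dist_place_sq hg hpg hrg, hA] at this
      rw [hpp, hrr, this]
      simpa [orient] using mul_pos hA0 hy
    obtain ⟨m, hm, hm'⟩ := exists_mem_interior_of_same_side
      (S := U.place f '' (f : Set V)) (T := U.place g '' (g : Set V))
      ⟨p, hpf, rfl⟩ ⟨r, hrf, rfl⟩ ⟨q, hqf, rfl⟩ ⟨p, hpg, hpp.symm⟩ ⟨r, hrg, hrr.symm⟩ ⟨t, htg, rfl⟩
      h1 h2
    exact Set.disjoint_left.1 (U.nonoverlapping f hf g hg hne) hm hm'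

/-- Two faces with a common interior point contradict the absence of overlaps. -/
theorem not_overlap {s : ℝ} {O I : Plane} {f g : Finset V} {p q r p' q' r' : V}
    {xp yp xq yq xr yr xp' yp' xq' yq' xr' yr' : ℝ} (hs : s * s = 1) (hOI : 0 < dist O I)
    (hf : f ∈ P.faces) (hg : g ∈ P.faces) (hne : f ≠ g)
    (hpf : p ∈ f) (hqf : q ∈ f) (hrf : r ∈ f) (hpg : p' ∈ g) (hqg : q' ∈ g) (hrg : r' ∈ g)
    (hp : U.Placed s O I f p xp yp) (hq : U.Placed s O I f q xq yq)
    (hr : U.Placed s O I f r xr yr) (hp' : U.Placed s O I g p' xp' yp')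
    (hq' : U.Placed s O I g q' xq' yq') (hr' : U.Placed s O I g r' xr' yr') (x y : ℝ)
    (h₁ : 0 < orient xp yp xq yq x y) (h₂ : 0 < orient xq yq xr yr x y)
    (h₃ : 0 < orient xr yr xp yp x y) (h₄ : 0 < orient xp' yp' xq' yq' x y)
    (h₅ : 0 < orient xq' yq' xr' yr' x y) (h₆ : 0 < orient xr' yr' xp' yp' x y) : False := by
  have key : ∀ {x₀ y₀ x₁ y₁ x₂ y₂}, 0 < orient x₀ y₀ x₁ y₁ x₂ y₂ →
      0 < s * cross (turn s O I x₀ y₀) (turn s O I x₁ y₁) (turn s O I x₂ y₂) := by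
    intro x₀ y₀ x₁ y₁ x₂ y₂ h
    rw [cross_turn hs]
    positivity
  exact Set.disjoint_left.1 (U.nonoverlapping f hf g hg hne)
    (mem_interior_convexHull (s := s) ⟨p, hpf, hp⟩ ⟨q, hqf, hq⟩ ⟨r, hrf, hr⟩
      (key h₁) (key h₂) (key h₃))
    (mem_interior_convexHull (s := s) ⟨p', hpg, hp'⟩ ⟨q', hqg, hq'⟩ ⟨r', hrg, hr'⟩
      (key h₄) (key h₅) (key h₆))

/-- Laying out the first face. -/
theorem exists_placed {f : Finset V} (hf : f ∈ P.faces) {p q r : V} (hp : p ∈ f) (hq : q ∈ f)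
    (hr : r ∈ f) {A B C : ℝ} (hA : dist (P.pos p) (P.pos q) ^ 2 = A)
    (hB : dist (P.pos p) (P.pos r) ^ 2 = B) (hC : dist (P.pos q) (P.pos r) ^ 2 = C) (hA0 : 0 < A)
    (x y : ℝ) (hx : 2 * A * x = A + B - C) (hxy : A * (x ^ 2 + y ^ 2) = B) (hy : y ≠ 0) :
    ∃ s O I, s * s = 1 ∧ 0 < dist O I ∧ U.Placed s O I f p 0 0 ∧ U.Placed s O I f q 1 0 ∧
      U.Placed s O I f r x y := by
  have hpq := (dist_place_sq (U := U) hf hp hq).trans hA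
  obtain ⟨s, hs, h⟩ := exists_turn_eq hpq
    ((dist_place_sq (U := U) hf hp hr).trans hB) ((dist_place_sq (U := U) hf hq hr).trans hC)
    hA0 hx hxy hy
  refine ⟨s, U.place f p, U.place f q, hs, ?_, (turn_origin _ _ _).symm, (turn_unit _ _ _).symm, h⟩
  refine lt_of_le_of_ne dist_nonneg fun h0 => ?_
  rw [← h0] at hpq
  norm_num at hpq
  linarith

end TriPolyhedron.EdgeUnfolding

/-! ### Shapes of the faces, and attaching one face around a brim vertex -/

section Obstructions

open TriPolyhedron

variable {U : spiked.EdgeUnfolding} {h : Fin 4} {i j k : Fin 3}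

theorem apexV_mem : ∀ h i, apexV h ∈ face (h, i, 0) := by decide +kernel

theorem brimV_mem_spike : ∀ {h i j}, i ≠ j → brimV h i ∈ face (h, j, 0) := by decide +kernel

theorem brimV_mem_inner : ∀ {h i j}, i ≠ j → brimV h i ∈ face (h, j, 1) := by decide +kernel

theorem hatCorner_mem_inner : ∀ h i, hatCorner h i ∈ face (h, i, 1) := by decide +kernel

theorem brimV_mem_outer : ∀ h i, brimV h i ∈ face (h, i, 2) := by decide +kernel

theorem hatCorner_mem_outer : ∀ {h i j}, i ≠ j → hatCorner h i ∈ face (h, j, 2) := by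
  decide +kernel

theorem face_mem (x : FaceIndex) : face x ∈ spiked.faces := mem_spikedFaces.2 ⟨x, rfl⟩

theorem dist_pos_sq_of_sqDist {u v : Fin 20} {n : ℤ} (huv : sqDist u v = n) :
    dist (spiked.pos u) (spiked.pos v) ^ 2 = n := by
  rw [← huv]
  exact dist_spikedPos_sq u v

theorem dist_apexV_brimV (h : Fin 4) (i : Fin 3) :
    dist (spiked.pos (apexV h)) (spiked.pos (brimV h i)) ^ 2 = 8036 := by
  have : ∀ h i, sqDist (apexV h) (brimV h i) = 8036 := by decide +kernel
  exact_mod_cast dist_pos_sq_of_sqDist (this h i)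

theorem dist_brimV_apexV (h : Fin 4) (i : Fin 3) :
    dist (spiked.pos (brimV h i)) (spiked.pos (apexV h)) ^ 2 = 8036 := by
  rw [dist_comm, dist_apexV_brimV]

theorem dist_brimV_brimV (hij : i ≠ j) :
    dist (spiked.pos (brimV h i)) (spiked.pos (brimV h j)) ^ 2 = 392 := by
  have : ∀ h i j, i ≠ j → sqDist (brimV h i) (brimV h j) = 392 := by decide +kernel
  exact_mod_cast dist_pos_sq_of_sqDist (this h i j hij)

theorem dist_brimV_hatCorner (hij : i ≠ j) :
    dist (spiked.pos (brimV h i)) (spiked.pos (hatCorner h j)) ^ 2 = 33380 := by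
  have : ∀ h i j, i ≠ j → sqDist (brimV h i) (hatCorner h j) = 33380 := by decide +kernel
  exact_mod_cast dist_pos_sq_of_sqDist (this h i j hij)

theorem dist_hatCorner_brimV (hij : i ≠ j) :
    dist (spiked.pos (hatCorner h j)) (spiked.pos (brimV h i)) ^ 2 = 33380 := by
  rw [dist_comm, dist_brimV_hatCorner hij]

theorem dist_hatCorner_hatCorner (hij : i ≠ j) :
    dist (spiked.pos (hatCorner h i)) (spiked.pos (hatCorner h j)) ^ 2 = 55112 := by
  have : ∀ h i j, i ≠ j → sqDist (hatCorner h i) (hatCorner h j) = 55112 := by decide +kernel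
  exact_mod_cast dist_pos_sq_of_sqDist (this h i j hij)

variable {s : ℝ} {O I : Plane} {f : Finset (Fin 20)} {p q r : Fin 20}
  {xp yp xq yq xr yr : ℝ}

/-- In this and the next four lemmas the face is turned counterclockwise about `brimV h i`. The
constants are the coordinates of its third vertex in the frame that puts `brimV h i` at 0 and the
other end of the common edge at 1; they follow from the squared side lengths 392, 8036, 33380 and
55112. -/
theorem placed_spike_up (hij : i ≠ j) (hik : i ≠ k) (hjk : j ≠ k) (hs : s * s = 1)
    (hOI : 0 < dist O I) (hp : U.Placed s O I f (brimV h i) xp yp) (hq : U.Placed s O I f q xq yq)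
    (hr : U.Placed s O I f (brimV h j) xr yr) (hJ : spiked.Joined U.cut f (face (h, k, 0)))
    (hpf : brimV h i ∈ f) (hqf : q ∈ f) (hrf : brimV h j ∈ f) (xt yt : ℝ)
    (hor : 0 < orient xp yp xq yq xr yr)
    (hxt : xt = xp + (1 / 2) * (xr - xp) - (9 / 2) * (yr - yp))
    (hyt : yt = yp + (1 / 2) * (yr - yp) + (9 / 2) * (xr - xp)) :
    U.Placed s O I (face (h, k, 0)) (brimV h i) xp yp ∧ U.Placed s O I (face (h, k, 0)) (brimV h j) xr yr ∧
      U.Placed s O I (face (h, k, 0)) (apexV h) xt yt :=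
  hp.next hs hOI hq hr hor hJ hpf hqf hrf (brimV_mem_spike hik) (brimV_mem_spike hjk) (apexV_mem h k)
    (dist_brimV_brimV hij) (dist_brimV_apexV h i) (dist_brimV_apexV h j)
    (by norm_num) (by norm_num) (by norm_num) (by norm_num) xt yt hxt hyt

theorem placed_spike_down (hij : i ≠ j) (hik : i ≠ k) (hjk : j ≠ k) (hs : s * s = 1)
    (hOI : 0 < dist O I) (hp : U.Placed s O I f (brimV h i) xp yp) (hq : U.Placed s O I f q xq yq)
    (hr : U.Placed s O I f (apexV h) xr yr) (hJ : spiked.Joined U.cut f (face (h, k, 0)))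
    (hpf : brimV h i ∈ f) (hqf : q ∈ f) (hrf : apexV h ∈ f) (xt yt : ℝ)
    (hor : 0 < orient xp yp xq yq xr yr)
    (hxt : xt = xp + (1 / 41) * (xr - xp) - (9 / 41) * (yr - yp))
    (hyt : yt = yp + (1 / 41) * (yr - yp) + (9 / 41) * (xr - xp)) :
    U.Placed s O I (face (h, k, 0)) (brimV h i) xp yp ∧ U.Placed s O I (face (h, k, 0)) (apexV h) xr yr ∧
      U.Placed s O I (face (h, k, 0)) (brimV h j) xt yt :=
  hp.next hs hOI hq hr hor hJ hpf hqf hrf (brimV_mem_spike hik) (apexV_mem h k) (brimV_mem_spike hjk)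
    (dist_brimV_apexV h i) (dist_brimV_brimV hij) (dist_apexV_brimV h j)
    (by norm_num) (by norm_num) (by norm_num) (by norm_num) xt yt hxt hyt

theorem placed_inner_up (hij : i ≠ j) (hik : i ≠ k) (hjk : j ≠ k) (hs : s * s = 1)
    (hOI : 0 < dist O I) (hp : U.Placed s O I f (brimV h i) xp yp) (hq : U.Placed s O I f q xq yq)
    (hr : U.Placed s O I f (brimV h j) xr yr) (hJ : spiked.Joined U.cut f (face (h, k, 1)))
    (hpf : brimV h i ∈ f) (hqf : q ∈ f) (hrf : brimV h j ∈ f) (xt yt : ℝ)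
    (hor : 0 < orient xp yp xq yq xr yr)
    (hxt : xt = xp + (1 / 2) * (xr - xp) - (129 / 14) * (yr - yp))
    (hyt : yt = yp + (1 / 2) * (yr - yp) + (129 / 14) * (xr - xp)) :
    U.Placed s O I (face (h, k, 1)) (brimV h i) xp yp ∧ U.Placed s O I (face (h, k, 1)) (brimV h j) xr yr ∧
      U.Placed s O I (face (h, k, 1)) (hatCorner h k) xt yt :=
  hp.next hs hOI hq hr hor hJ hpf hqf hrf (brimV_mem_inner hik) (brimV_mem_inner hjk) (hatCorner_mem_inner h k)
    (dist_brimV_brimV hij) (dist_brimV_hatCorner hik) (dist_brimV_hatCorner hjk)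
    (by norm_num) (by norm_num) (by norm_num) (by norm_num) xt yt hxt hyt

theorem placed_inner_down (hij : i ≠ j) (hik : i ≠ k) (hjk : j ≠ k) (hs : s * s = 1)
    (hOI : 0 < dist O I) (hp : U.Placed s O I f (brimV h i) xp yp) (hq : U.Placed s O I f q xq yq)
    (hr : U.Placed s O I f (hatCorner h k) xr yr) (hJ : spiked.Joined U.cut f (face (h, k, 1)))
    (hpf : brimV h i ∈ f) (hqf : q ∈ f) (hrf : hatCorner h k ∈ f) (xt yt : ℝ)
    (hor : 0 < orient xp yp xq yq xr yr)
    (hxt : xt = xp + (49 / 8345) * (xr - xp) - (903 / 8345) * (yr - yp))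
    (hyt : yt = yp + (49 / 8345) * (yr - yp) + (903 / 8345) * (xr - xp)) :
    U.Placed s O I (face (h, k, 1)) (brimV h i) xp yp ∧ U.Placed s O I (face (h, k, 1)) (hatCorner h k) xr yr ∧
      U.Placed s O I (face (h, k, 1)) (brimV h j) xt yt :=
  hp.next hs hOI hq hr hor hJ hpf hqf hrf (brimV_mem_inner hik) (hatCorner_mem_inner h k) (brimV_mem_inner hjk)
    (dist_brimV_hatCorner hik) (dist_brimV_brimV hij) (dist_hatCorner_brimV hjk)
    (by norm_num) (by norm_num) (by norm_num) (by norm_num) xt yt hxt hyt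

theorem placed_outer (hij : i ≠ j) (hik : i ≠ k) (hjk : j ≠ k) (hs : s * s = 1)
    (hOI : 0 < dist O I) (hp : U.Placed s O I f (brimV h i) xp yp) (hq : U.Placed s O I f q xq yq)
    (hr : U.Placed s O I f (hatCorner h j) xr yr) (hJ : spiked.Joined U.cut f (face (h, i, 2)))
    (hpf : brimV h i ∈ f) (hqf : q ∈ f) (hrf : hatCorner h j ∈ f) (xt yt : ℝ)
    (hor : 0 < orient xp yp xq yq xr yr)
    (hxt : xt = xp + (1456 / 8345) * (xr - xp) - (8217 / 8345) * (yr - yp))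
    (hyt : yt = yp + (1456 / 8345) * (yr - yp) + (8217 / 8345) * (xr - xp)) :
    U.Placed s O I (face (h, i, 2)) (brimV h i) xp yp ∧ U.Placed s O I (face (h, i, 2)) (hatCorner h j) xr yr ∧
      U.Placed s O I (face (h, i, 2)) (hatCorner h k) xt yt :=
  hp.next hs hOI hq hr hor hJ hpf hqf hrf (brimV_mem_outer h i) (hatCorner_mem_outer hij.symm) (hatCorner_mem_outer hik.symm)
    (dist_brimV_hatCorner hij) (dist_brimV_hatCorner hik) (dist_hatCorner_hatCorner hjk)
    (by norm_num) (by norm_num) (by norm_num) (by norm_num) xt yt hxt hyt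

end Obstructions

/-! ### Attachments that force an overlap -/

section Obstructions

open TriPolyhedron TriPolyhedron.EdgeUnfolding

variable {U : spiked.EdgeUnfolding} {h : Fin 4} {i j k : Fin 3}

theorem face_ne {x y : FaceIndex} (hxy : x ≠ y) : face x ≠ face y := fun h =>
  hxy (face_injective x y h)

/-- The faces around a brim vertex cannot all be attached except along the edge to the apex. -/
theorem false_of_cut_apex_edge (hij : i ≠ j) (hik : i ≠ k) (hjk : j ≠ k)
    (h₁ : spiked.Joined U.cut (face (h, k, 0)) (face (h, k, 1)))
    (h₂ : spiked.Joined U.cut (face (h, k, 1)) (face (h, i, 2)))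
    (h₃ : spiked.Joined U.cut (face (h, i, 2)) (face (h, j, 1)))
    (h₄ : spiked.Joined U.cut (face (h, j, 1)) (face (h, j, 0))) : False := by
  obtain ⟨s, O, I, hs, hOI, p0, b0, a0⟩ := exists_placed (U := U) (face_mem (h, k, 0))
    (brimV_mem_spike hik) (brimV_mem_spike hjk) (apexV_mem h k)
    (dist_brimV_brimV hij) (dist_brimV_apexV h i) (dist_brimV_apexV h j) (by norm_num) (1 / 2) (-9 / 2)
    (by norm_num) (by norm_num) (by norm_num)
  obtain ⟨p1, b1, c1⟩ := placed_inner_up hij hik hjk hs hOI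
    p0 a0 b0 h₁ (brimV_mem_spike hik) (apexV_mem h k) (brimV_mem_spike hjk) (1 / 2) (129 / 14)
    (by norm_num [orient]) (by norm_num) (by norm_num)
  obtain ⟨p2, c2, d2⟩ := placed_outer hik hij hjk.symm hs hOI
    p1 b1 c1 h₂ (brimV_mem_inner hik) (brimV_mem_inner hjk) (hatCorner_mem_inner h k) (-629 / 70) (21 / 10)
    (by norm_num [orient]) (by norm_num) (by norm_num)
  obtain ⟨p3, d3, e3⟩ := placed_inner_down hik hij hjk.symm hs hOI
    p2 c2 d2 h₃ (brimV_mem_outer h i) (hatCorner_mem_outer hik.symm) (hatCorner_mem_outer hij.symm) (-7 / 25) (-24 / 25)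
    (by norm_num [orient]) (by norm_num) (by norm_num)
  obtain ⟨p4, e4, a4⟩ := placed_spike_up hik hij hjk.symm hs hOI
    p3 d3 e3 h₄ (brimV_mem_inner hij) (hatCorner_mem_inner h j) (brimV_mem_inner hjk.symm) (209 / 50) (-87 / 50)
    (by norm_num [orient]) (by norm_num) (by norm_num)
  -- The five faces turn through more than a full angle, so the last one covers part of the first.
  -- The explicit point lies strictly inside both; the vertices are listed counterclockwise.
  exact not_overlap hs hOI (face_mem (h, k, 0)) (face_mem (h, j, 0)) (face_ne (by simp [hjk.symm]))
    (brimV_mem_spike hik) (apexV_mem h k) (brimV_mem_spike hjk)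
    (brimV_mem_spike hij) (brimV_mem_spike hjk.symm) (apexV_mem h j)
    p0 a0 b0 p4 e4 a4
    (1 / 2) (-1 / 2) (by norm_num [orient]) (by norm_num [orient]) (by norm_num [orient])
    (by norm_num [orient]) (by norm_num [orient]) (by norm_num [orient])

/-- The faces around a brim vertex cannot all be attached except along an edge of the base of the spike. -/
theorem false_of_cut_brim_edge (hij : i ≠ j) (hik : i ≠ k) (hjk : j ≠ k)
    (h₂ : spiked.Joined U.cut (face (h, k, 1)) (face (h, i, 2)))
    (h₃ : spiked.Joined U.cut (face (h, i, 2)) (face (h, j, 1)))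
    (h₄ : spiked.Joined U.cut (face (h, j, 1)) (face (h, j, 0)))
    (h₅ : spiked.Joined U.cut (face (h, j, 0)) (face (h, k, 0))) : False := by
  obtain ⟨s, O, I, hs, hOI, p1, b1, c1⟩ := exists_placed (U := U) (face_mem (h, k, 1))
    (brimV_mem_inner hik) (brimV_mem_inner hjk) (hatCorner_mem_inner h k)
    (dist_brimV_brimV hij) (dist_brimV_hatCorner hik) (dist_brimV_hatCorner hjk) (by norm_num) (1 / 2) (129 / 14)
    (by norm_num) (by norm_num) (by norm_num)
  obtain ⟨p2, c2, d2⟩ := placed_outer hik hij hjk.symm hs hOI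
    p1 b1 c1 h₂ (brimV_mem_inner hik) (brimV_mem_inner hjk) (hatCorner_mem_inner h k) (-629 / 70) (21 / 10)
    (by norm_num [orient]) (by norm_num) (by norm_num)
  obtain ⟨p3, d3, e3⟩ := placed_inner_down hik hij hjk.symm hs hOI
    p2 c2 d2 h₃ (brimV_mem_outer h i) (hatCorner_mem_outer hik.symm) (hatCorner_mem_outer hij.symm) (-7 / 25) (-24 / 25)
    (by norm_num [orient]) (by norm_num) (by norm_num)
  obtain ⟨p4, e4, a4⟩ := placed_spike_up hik hij hjk.symm hs hOI
    p3 d3 e3 h₄ (brimV_mem_inner hij) (hatCorner_mem_inner h j) (brimV_mem_inner hjk.symm) (209 / 50) (-87 / 50)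
    (by norm_num [orient]) (by norm_num) (by norm_num)
  obtain ⟨p5, a5, b5⟩ := placed_spike_down hij hik hjk hs hOI
    p4 e4 a4 h₅ (brimV_mem_spike hij) (brimV_mem_spike hjk.symm) (apexV_mem h j) (496 / 1025) (897 / 1025)
    (by norm_num [orient]) (by norm_num) (by norm_num)
  exact not_overlap hs hOI (face_mem (h, k, 1)) (face_mem (h, k, 0)) (face_ne (by simp))
    (brimV_mem_inner hik) (brimV_mem_inner hjk) (hatCorner_mem_inner h k)
    (brimV_mem_spike hik) (apexV_mem h k) (brimV_mem_spike hjk)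
    p1 b1 c1 p5 a5 b5
    (1 / 2) (1 / 2) (by norm_num [orient]) (by norm_num [orient]) (by norm_num [orient])
    (by norm_num [orient]) (by norm_num [orient]) (by norm_num [orient])

/-- The faces around a brim vertex cannot all be attached except along an edge to a corner. -/
theorem false_of_cut_corner_edge (hij : i ≠ j) (hik : i ≠ k) (hjk : j ≠ k)
    (h₃ : spiked.Joined U.cut (face (h, i, 2)) (face (h, j, 1)))
    (h₄ : spiked.Joined U.cut (face (h, j, 1)) (face (h, j, 0)))
    (h₅ : spiked.Joined U.cut (face (h, j, 0)) (face (h, k, 0)))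
    (h₁ : spiked.Joined U.cut (face (h, k, 0)) (face (h, k, 1))) : False := by
  obtain ⟨s, O, I, hs, hOI, p2, c2, d2⟩ := exists_placed (U := U) (face_mem (h, i, 2))
    (brimV_mem_outer h i) (hatCorner_mem_outer hik.symm) (hatCorner_mem_outer hij.symm)
    (dist_brimV_hatCorner hik) (dist_brimV_hatCorner hij) (dist_hatCorner_hatCorner hjk.symm) (by norm_num) (1456 / 8345) (8217 / 8345)
    (by norm_num) (by norm_num) (by norm_num)
  obtain ⟨p3, d3, e3⟩ := placed_inner_down hik hij hjk.symm hs hOI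
    p2 c2 d2 h₃ (brimV_mem_outer h i) (hatCorner_mem_outer hik.symm) (hatCorner_mem_outer hij.symm) (-4403 / 41725) (1029 / 41725)
    (by norm_num [orient]) (by norm_num) (by norm_num)
  obtain ⟨p4, e4, a4⟩ := placed_spike_up hik hij hjk.symm hs hOI
    p3 d3 e3 h₄ (brimV_mem_inner hij) (hatCorner_mem_inner h j) (brimV_mem_inner hjk.symm) (-6832 / 41725) (-19299 / 41725)
    (by norm_num [orient]) (by norm_num) (by norm_num)
  obtain ⟨p5, a5, b5⟩ := placed_spike_down hij hik hjk hs hOI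
    p4 e4 a4 h₅ (brimV_mem_spike hij) (brimV_mem_spike hjk.symm) (apexV_mem h j) (166859 / 1710725) (-80787 / 1710725)
    (by norm_num [orient]) (by norm_num) (by norm_num)
  obtain ⟨p6, b6, c6⟩ := placed_inner_up hij hik hjk hs hOI
    p5 a5 b5 h₁ (brimV_mem_spike hik) (apexV_mem h k) (brimV_mem_spike hjk) (496 / 1025) (897 / 1025)
    (by norm_num [orient]) (by norm_num) (by norm_num)
  exact not_overlap hs hOI (face_mem (h, i, 2)) (face_mem (h, k, 1)) (face_ne (by simp [hik]))
    (brimV_mem_outer h i) (hatCorner_mem_outer hik.symm) (hatCorner_mem_outer hij.symm)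
    (brimV_mem_inner hik) (brimV_mem_inner hjk) (hatCorner_mem_inner h k)
    p2 c2 d2 p6 b6 c6
    (3 / 10) (1 / 2) (by norm_num [orient]) (by norm_num [orient]) (by norm_num [orient])
    (by norm_num [orient]) (by norm_num [orient]) (by norm_num [orient])

/-- Rolled out from the spike triangle `a b_k b_i` around `b_k` and then around `b_j`, the brim runs into the spike. -/
theorem false_of_hamiltonian_cut (hij : i ≠ j) (hik : i ≠ k) (hjk : j ≠ k)
    (h₁ : spiked.Joined U.cut (face (h, j, 0)) (face (h, j, 1)))
    (h₂ : spiked.Joined U.cut (face (h, j, 1)) (face (h, k, 2)))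
    (h₃ : spiked.Joined U.cut (face (h, k, 2)) (face (h, i, 1)))
    (h₄ : spiked.Joined U.cut (face (h, i, 1)) (face (h, j, 2)))
    (h₅ : spiked.Joined U.cut (face (h, j, 2)) (face (h, k, 1))) : False := by
  obtain ⟨s, O, I, hs, hOI, p0, b0, a0⟩ := exists_placed (U := U) (face_mem (h, j, 0))
    (brimV_mem_spike hjk.symm) (brimV_mem_spike hij) (apexV_mem h j)
    (dist_brimV_brimV hik.symm) (dist_brimV_apexV h k) (dist_brimV_apexV h i) (by norm_num) (1 / 2) (-9 / 2)
    (by norm_num) (by norm_num) (by norm_num)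
  obtain ⟨p1, b1, c1⟩ := placed_inner_up hik.symm hjk.symm hij hs hOI
    p0 a0 b0 h₁ (brimV_mem_spike hjk.symm) (apexV_mem h j) (brimV_mem_spike hij) (1 / 2) (129 / 14)
    (by norm_num [orient]) (by norm_num) (by norm_num)
  obtain ⟨p2, c2, d2⟩ := placed_outer hjk.symm hik.symm hij.symm hs hOI
    p1 b1 c1 h₂ (brimV_mem_inner hjk.symm) (brimV_mem_inner hij) (hatCorner_mem_inner h j) (-629 / 70) (21 / 10)
    (by norm_num [orient]) (by norm_num) (by norm_num)
  obtain ⟨p3, d3, e3⟩ := placed_inner_down hjk.symm hik.symm hij.symm hs hOI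
    p2 c2 d2 h₃ (brimV_mem_outer h k) (hatCorner_mem_outer hjk) (hatCorner_mem_outer hik) (-7 / 25) (-24 / 25)
    (by norm_num [orient]) (by norm_num) (by norm_num)
  -- Here the pivot changes from `brimV h k` to `brimV h j`.
  obtain ⟨e4, d4, c4⟩ := placed_outer hij.symm hjk hik hs hOI
    e3 p3 d3 h₄ (brimV_mem_inner hij.symm) (brimV_mem_inner hik.symm) (hatCorner_mem_inner h i) (-1203 / 250) (-15747 / 1750)
    (by norm_num [orient]) (by norm_num) (by norm_num)
  obtain ⟨e5, c5, b5⟩ := placed_inner_down hij.symm hjk hik hs hOI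
    e4 d4 c4 h₅ (brimV_mem_outer h j) (hatCorner_mem_outer hij) (hatCorner_mem_outer hjk.symm) (352 / 625) (-936 / 625)
    (by norm_num [orient]) (by norm_num) (by norm_num)
  exact not_overlap hs hOI (face_mem (h, j, 0)) (face_mem (h, k, 1)) (face_ne (by simp [hjk]))
    (brimV_mem_spike hjk.symm) (apexV_mem h j) (brimV_mem_spike hij)
    (brimV_mem_inner hjk) (hatCorner_mem_inner h k) (brimV_mem_inner hik)
    p0 a0 b0 e5 c5 b5
    (1 / 2) (-3 / 2) (by norm_num [orient]) (by norm_num [orient]) (by norm_num [orient])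
    (by norm_num [orient]) (by norm_num [orient]) (by norm_num [orient])

theorem eq_of_turn_eq {s : ℝ} (hs : s * s = 1) {O I : Plane} (hOI : 0 < dist O I)
    {x y x' y' : ℝ} (h : turn s O I x y = turn s O I x' y') : y = y' := by
  have h0 := congrArg (fun p : Plane => p 0) h
  have h1 := congrArg (fun p : Plane => p 1) h
  simp only [turn_apply_zero, turn_apply_one] at h0 h1
  have hd : dist O I ^ 2 * (y - y') = 0 := by
    rw [dist_sq_plane]
    linear_combination (s * (I 0 - O 0)) * h1 - (s * (I 1 - O 1)) * h0 -
      (y - y') * ((I 0 - O 0) ^ 2 + (I 1 - O 1) ^ 2) * hs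
  have := (mul_eq_zero.1 hd).resolve_left (by positivity)
  linarith

/-- The faces of a spike cannot all be attached to each other. -/
theorem false_of_uncut_spike (hij : i ≠ j) (hik : i ≠ k) (hjk : j ≠ k)
    (h₁ : spiked.Joined U.cut (face (h, k, 0)) (face (h, i, 0)))
    (h₂ : spiked.Joined U.cut (face (h, i, 0)) (face (h, j, 0)))
    (h₃ : spiked.Joined U.cut (face (h, j, 0)) (face (h, k, 0))) : False := by
  obtain ⟨s, O, I, hs, hOI, p0, b0, c0⟩ := exists_placed (U := U) (face_mem (h, k, 0))
    (apexV_mem h k) (brimV_mem_spike hik) (brimV_mem_spike hjk)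
    (dist_apexV_brimV h i) (dist_apexV_brimV h j) (dist_brimV_brimV hij) (by norm_num) (40 / 41) (9 / 41)
    (by norm_num) (by norm_num) (by norm_num)
  obtain ⟨p1, c1, d1⟩ := p0.next hs hOI b0 c0 (by norm_num [orient]) h₁
    (apexV_mem h k) (brimV_mem_spike hik) (brimV_mem_spike hjk) (apexV_mem h i) (brimV_mem_spike hij.symm) (brimV_mem_spike hik.symm)
    (dist_apexV_brimV h j) (dist_apexV_brimV h k) (dist_brimV_brimV hjk) (by norm_num)
    (x := (40 / 41)) (y := (9 / 41)) (by norm_num) (by norm_num) (by norm_num) (1519 / 1681) (720 / 1681)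
    (by norm_num) (by norm_num)
  obtain ⟨p2, d2, e2⟩ := p1.next hs hOI c1 d1 (by norm_num [orient]) h₂
    (apexV_mem h i) (brimV_mem_spike hij.symm) (brimV_mem_spike hik.symm) (apexV_mem h j) (brimV_mem_spike hjk.symm) (brimV_mem_spike hij)
    (dist_apexV_brimV h k) (dist_apexV_brimV h i) (dist_brimV_brimV hik.symm) (by norm_num)
    (x := (40 / 41)) (y := (9 / 41)) (by norm_num) (by norm_num) (by norm_num) (54280 / 68921) (42471 / 68921)
    (by norm_num) (by norm_num)
  -- The edges at the apex have been turned by powers of (40 + 9i)/41. After three faces `brimV h i`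
  -- sits at its cube, whose imaginary part is not 0, although the uncut last edge would require it
  -- to be at 1.
  have := U.attached _ _ h₃ (brimV h i) (Finset.mem_inter.2 ⟨(brimV_mem_spike hij), (brimV_mem_spike hik)⟩)
  rw [b0, e2] at this
  have := eq_of_turn_eq hs hOI this
  norm_num at this

end Obstructions

/-! ### Counting uncut edges -/

section Counting

open TriPolyhedron TriPolyhedron.EdgeUnfolding

/-- The four families of interior edges of the hat `h`, as pairs of adjacent faces: edges at the
apex, edges of the base of the spike, and two families of edges to the corners. -/
def hatPair (h : Fin 4) (t : Fin 4) (i : Fin 3) : FaceIndex × FaceIndex :=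
  match t with
  | 0 => ((h, i + 1, 0), (h, i + 2, 0))
  | 1 => ((h, i, 0), (h, i, 1))
  | 2 => ((h, i, 2), (h, i + 1, 1))
  | 3 => ((h, i, 2), (h, i + 2, 1))

/-- The pair of faces at the edge between two corners. -/
def rimPair (x : Fin 4 × Fin 3) : Sym2 FaceIndex :=
  s((x.1, x.2, 2), (x.1 ^^^ x.2.succ, x.2, 2))

theorem card_image_rimPair : (Finset.univ.image rimPair).card = 6 := by decide +kernel

theorem eq_hatPair_or_rimPair : ∀ x y, (face x ∩ face y).card = 2 →
    (∃ h t i, s((hatPair h t i).1, (hatPair h t i).2) = s(x, y)) ∨ ∃ z, rimPair z = s(x, y) := by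
  decide +kernel

theorem spike_neighbor : ∀ h i y, (face (h, i, 0) ∩ face y).card = 2 →
    y = (h, i + 1, 0) ∨ y = (h, i + 2, 0) ∨ y = (h, i, 1) := by
  decide +kernel

set_option synthInstance.maxSize 100000 in
set_option synthInstance.maxHeartbeats 2000000 in
/-- Local restrictions on the uncut edges of a hat force at least five cuts. The arguments are
the uncut edges at the apex, at the base of the spike, and to the corners. -/
theorem hat_card_le : ∀ a b c d : Fin 3 → Bool, (¬ ∀ i, a i) ∧
    (∀ i, (a i).toNat + (b (i + 1)).toNat + (b (i + 2)).toNat + (c i).toNat + (d i).toNat ≤ 3) ∧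
    (∀ k, ¬ (b (k + 1) ∧ c k ∧ d k ∧ c (k + 1) ∧ d (k + 1))) ∧
    (∀ k, ¬ (b (k + 2) ∧ c k ∧ d k ∧ c (k + 2) ∧ d (k + 2))) ∧
    (∀ i, a (i + 1) ∨ a (i + 2) ∨ b i) ∧
    (∀ i, a (i + 1) ∨ a (i + 2) ∨ b (i + 1) ∨ b (i + 2)) ∧ (∃ i, b i) →
    ∑ i, ((a i).toNat + (b i).toNat + (c i).toNat + (d i).toNat) ≤ 7 := by
  -- The hypotheses say, in order: some apex edge is cut; two edges are cut at each brim vertex;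
  -- neither direction of the path from apex to corner occurs as a cut; and no one, two or all three
  -- spike faces are cut off. Four cuts would need degree sum 7 with at most three edges inside the
  -- spike, which leaves only those paths.
  decide +kernel

set_option synthInstance.maxSize 100000 in
set_option synthInstance.maxHeartbeats 2000000 in
theorem toNat_sum_le_three : ∀ a b c d e : Bool, ¬ (a ∧ b ∧ c ∧ d) ∧ ¬ (a ∧ b ∧ c ∧ e) ∧
    ¬ (a ∧ b ∧ d ∧ e) ∧ ¬ (a ∧ c ∧ d ∧ e) ∧ ¬ (b ∧ c ∧ d ∧ e) →
    a.toNat + b.toNat + c.toNat + d.toNat + e.toNat ≤ 3 := by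
  decide +kernel

theorem TriPolyhedron.Joined.symm {V : Type} [Fintype V] [DecidableEq V] {P : TriPolyhedron V}
    {cut : Set (Finset V)} {f g : Finset V} (h : P.Joined cut f g) : P.Joined cut g f := by
  obtain ⟨hf, hg, hcard, hcut⟩ := h
  exact ⟨hg, hf, by rwa [Finset.inter_comm], by rwa [Finset.inter_comm]⟩

/-- A sequence of joined faces from inside `S` to outside must cross the boundary of `S`. Applied to
sets of spike faces, this excludes cycles of cut edges in the spike. -/
theorem TriPolyhedron.EdgeUnfolding.IsSinglePiece.exists_joined {V : Type} [Fintype V]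
    [DecidableEq V] {P : TriPolyhedron V} {U : P.EdgeUnfolding} (hU : U.IsSinglePiece)
    {S : Set (Finset V)} {f g : Finset V} (hf : f ∈ P.faces) (hg : g ∈ P.faces) (hfS : f ∈ S)
    (hgS : g ∉ S) : ∃ x ∈ S, ∃ y ∉ S, P.Joined U.cut x y := by
  by_contra hn
  push Not at hn
  have : ∀ y, Relation.ReflTransGen (P.Joined U.cut) f y → y ∈ S := by
    intro y hy
    induction hy with
    | refl => exact hfS
    | tail _ hxy ih =>
      by_contra hyS
      exact hn _ ih _ hyS hxy
  exact hgS (this g (hU f hf g hg))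

open Classical in
/-- The number of uncut edges in a hat is at most seven. -/
theorem card_uncut_hat_le {U : spiked.EdgeUnfolding} (hU : U.IsSinglePiece) (h : Fin 4) :
    (Finset.univ.filter fun e : Fin 4 × Fin 3 => spiked.Joined U.cut
      (face (hatPair h e.1 e.2).1) (face (hatPair h e.1 e.2).2)).card ≤ 7 := by
  let J : Fin 4 → Fin 3 → Bool := fun t i => decide (spiked.Joined U.cut
      (face (hatPair h t i).1) (face (hatPair h t i).2))
  have hcount : (Finset.univ.filter fun e : Fin 4 × Fin 3 => spiked.Joined U.cut
      (face (hatPair h e.1 e.2).1) (face (hatPair h e.1 e.2).2)).card =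
      ∑ i, ((J 0 i).toNat + (J 1 i).toNat + (J 2 i).toNat + (J 3 i).toNat) := by
    rw [Finset.card_filter, Fintype.sum_prod_type_right]
    refine Finset.sum_congr rfl fun i _ => ?_
    rw [Fin.sum_univ_four]
    simp only [J, Bool.toNat, Bool.cond_decide]
  rw [hcount]
  have n1 : ∀ i : Fin 3, i ≠ i + 1 := by decide
  have n2 : ∀ i : Fin 3, i ≠ i + 2 := by decide
  have n3 : ∀ i : Fin 3, i + 1 ≠ i + 2 := by decide
  have e1 : ∀ i : Fin 3, i + 1 + 1 = i + 2 := by decide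
  have e2 : ∀ i : Fin 3, i + 1 + 2 = i := by decide
  have e3 : ∀ i : Fin 3, i + 2 + 1 = i := by decide
  have e4 : ∀ i : Fin 3, i + 2 + 2 = i + 1 := by decide
  have j0 : ∀ i, J 0 i = true → spiked.Joined U.cut (face (h, i + 1, 0)) (face (h, i + 2, 0)) :=
    fun i hi => of_decide_eq_true hi
  have j1 : ∀ i, J 1 i = true → spiked.Joined U.cut (face (h, i, 0)) (face (h, i, 1)) :=
    fun i hi => of_decide_eq_true hi
  have j2 : ∀ i, J 2 i = true → spiked.Joined U.cut (face (h, i, 2)) (face (h, i + 1, 1)) :=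
    fun i hi => of_decide_eq_true hi
  have j3 : ∀ i, J 3 i = true → spiked.Joined U.cut (face (h, i, 2)) (face (h, i + 2, 1)) :=
    fun i hi => of_decide_eq_true hi
  have r0 : ∀ i, spiked.Joined U.cut (face (h, i + 1, 0)) (face (h, i + 2, 0)) → J 0 i = true :=
    fun i hi => decide_eq_true hi
  have r1 : ∀ i, spiked.Joined U.cut (face (h, i, 0)) (face (h, i, 1)) → J 1 i = true :=
    fun i hi => decide_eq_true hi
  have r0' : ∀ i, spiked.Joined U.cut (face (h, i, 0)) (face (h, i + 1, 0)) →
      J 0 (i + 2) = true := fun i hi => r0 _ (by rwa [e3, e4])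
  have r0'' : ∀ i, spiked.Joined U.cut (face (h, i, 0)) (face (h, i + 2, 0)) →
      J 0 (i + 1) = true := fun i hi => r0 _ (by rw [e1, e2]; exact hi.symm)
  have out : ∀ i y, spiked.Joined U.cut (face (h, i, 0)) y →
      (y = face (h, i + 1, 0) ∧ J 0 (i + 2) = true) ∨
      (y = face (h, i + 2, 0) ∧ J 0 (i + 1) = true) ∨ J 1 i = true := by
    intro i y hy
    obtain ⟨x, rfl⟩ := mem_spikedFaces.1 hy.2.1
    rcases spike_neighbor h i x hy.2.2.1 with rfl | rfl | rfl
    · exact Or.inl ⟨rfl, r0' i hy⟩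
    · exact Or.inr (Or.inl ⟨rfl, r0'' i hy⟩)
    · exact Or.inr (Or.inr (r1 i hy))
  refine hat_card_le (J 0) (J 1) (J 2) (J 3) ⟨?_, ?_, ?_, ?_, ?_, ?_, ?_⟩
  · intro ha
    exact false_of_uncut_spike (h := h) (i := 0) (j := 1) (k := 2) (by decide) (by decide)
      (by decide) (j0 1 (ha 1)) (j0 2 (ha 2)) (j0 0 (ha 0))
  · intro i
    have b1 := j1 (i + 1)
    have b2 := j1 (i + 2)
    have c0 := j2 i
    have d0 := j3 i
    have a0 := j0 i
    -- Each case leaves out one of the five edges at `brimV h i`: the two corner edges, the two base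
    -- edges and the apex edge.
    refine toNat_sum_le_three _ _ _ _ _ ⟨?_, ?_, ?_, ?_, ?_⟩
    · rintro ⟨a, b, b', c⟩
      exact false_of_cut_corner_edge (n1 i) (n2 i) (n3 i) (c0 c) (b1 b).symm (a0 a) (b2 b')
    -- The mirror image of the previous case: the other two brim vertices are exchanged and the
    -- faces are traversed in reverse.
    · rintro ⟨a, b, b', d⟩
      exact false_of_cut_corner_edge (n2 i) (n1 i) (n3 i).symm (d0 d) (b2 b').symm (a0 a).symm
        (b1 b)
    · rintro ⟨a, b, c, d⟩
      exact false_of_cut_brim_edge (n1 i) (n2 i) (n3 i) (d0 d).symm (c0 c) (b1 b).symm (a0 a)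
    · rintro ⟨a, b, c, d⟩
      exact false_of_cut_brim_edge (n2 i) (n1 i) (n3 i).symm (c0 c).symm (d0 d) (b2 b).symm
        (a0 a).symm
    · rintro ⟨b, b', c, d⟩
      exact false_of_cut_apex_edge (n1 i) (n2 i) (n3 i) (b2 b') (d0 d).symm (c0 c) (b1 b).symm
  · rintro k ⟨b, c, d, c', d'⟩
    have c'' := j2 _ c'
    have d'' := j3 _ d'
    rw [e1] at c''
    rw [e2] at d''
    exact false_of_hamiltonian_cut (n3 k).symm (n2 k).symm (n1 k).symm (j1 _ b) (j2 _ c).symm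
      (j3 _ d) c''.symm d''
  · rintro k ⟨b, c, d, c', d'⟩
    have c'' := j2 _ c'
    have d'' := j3 _ d'
    rw [e3] at c''
    rw [e4] at d''
    exact false_of_hamiltonian_cut (n3 k) (n1 k).symm (n2 k).symm (j1 _ b) (j3 _ d).symm
      (j2 _ c) d''.symm c''
  · intro i
    obtain ⟨x, rfl, y, -, hxy⟩ := hU.exists_joined (S := {face (h, i, 0)})
      (face_mem (h, i, 0)) (face_mem (h, i, 1)) rfl (face_ne (by simp))
    rcases out i y hxy with h1 | h1 | h1
    · exact Or.inr (Or.inl h1.2)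
    · exact Or.inl h1.2
    · exact Or.inr (Or.inr h1)
  · intro i
    -- The edge leaving the pair of spike faces cannot be the one they share, so it is one of the
    -- four on the boundary of their union.
    obtain ⟨x, hx, y, hy, hxy⟩ := hU.exists_joined
      (S := {face (h, i + 1, 0), face (h, i + 2, 0)})
      (face_mem (h, i + 1, 0)) (face_mem (h, i, 1)) (Or.inl rfl)
      (by rintro (h1 | h1) <;> exact face_ne (by simp) h1)
    rcases hx with rfl | rfl
    · rcases out (i + 1) y hxy with h1 | h1 | h1
      · rw [e1] at h1
        exact absurd (Or.inr h1.1) hy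
      · rw [e1] at h1
        exact Or.inr (Or.inl h1.2)
      · exact Or.inr (Or.inr (Or.inl h1))
    · rcases out (i + 2) y hxy with h1 | h1 | h1
      · rw [e4] at h1
        exact Or.inl h1.2
      · rw [e4] at h1
        exact absurd (Or.inl h1.1) hy
      · exact Or.inr (Or.inr (Or.inr h1))
  · obtain ⟨x, ⟨i, rfl⟩, y, hy, hxy⟩ := hU.exists_joined
      (S := Set.range fun i => face (h, i, 0))
      (face_mem (h, 0, 0)) (face_mem (h, 0, 1)) ⟨0, rfl⟩
      (by rintro ⟨i, h1⟩; exact face_ne (by simp) h1)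
    rcases out i y hxy with h1 | h1 | h1
    · exact absurd ⟨_, h1.1.symm⟩ hy
    · exact absurd ⟨_, h1.1.symm⟩ hy
    · exact ⟨i, h1⟩

theorem spiked_isUnunfoldable : spiked.IsUnunfoldable := by
  classical
  rintro ⟨U, hU⟩
  let G : SimpleGraph FaceIndex :=
    { Adj := fun x y => x ≠ y ∧ spiked.Joined U.cut (face x) (face y)
      symm := ⟨fun _ _ h => ⟨h.1.symm, h.2.symm⟩⟩
      loopless := ⟨fun _ h => h.1 rfl⟩ }
  have hreach : ∀ x f, Relation.ReflTransGen (spiked.Joined U.cut) (face x) f →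
      ∃ y, face y = f ∧ G.Reachable x y := by
    intro x f hf
    induction hf with
    | refl => exact ⟨x, rfl, .refl _⟩
    | tail _ hfg ih =>
      obtain ⟨y, rfl, hy⟩ := ih
      obtain ⟨z, rfl⟩ := mem_spikedFaces.1 hfg.2.1
      by_cases hyz : y = z
      · exact ⟨y, by rw [hyz], hy⟩
      · have hadj : G.Adj y z := ⟨hyz, hfg⟩
        exact ⟨z, rfl, hy.trans hadj.reachable⟩
  have hconn : G.Connected :=
    { preconnected := fun x y => by
        obtain ⟨z, hz, hr⟩ := hreach x _ (hU _ (face_mem x) _ (face_mem y))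
        rwa [face_injective z y hz] at hr
      nonempty := inferInstance }
  have hcard := hconn.card_vert_le_card_edgeSet_add_one
  let A : Fin 4 → Finset (Sym2 FaceIndex) := fun h =>
    (Finset.univ.filter fun e : Fin 4 × Fin 3 => spiked.Joined U.cut
      (face (hatPair h e.1 e.2).1) (face (hatPair h e.1 e.2).2)).image
      fun e => s((hatPair h e.1 e.2).1, (hatPair h e.1 e.2).2)
  have hsub : G.edgeSet ⊆
      ((Finset.univ.biUnion A ∪ Finset.univ.image rimPair : Finset (Sym2 FaceIndex)) : Set _) := by
    intro e
    induction e using Sym2.ind with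
    | _ x y =>
      rintro ⟨-, hxy⟩
      rw [Finset.mem_coe, Finset.mem_union]
      rcases eq_hatPair_or_rimPair x y hxy.2.2.1 with ⟨h, t, i, he⟩ | ⟨z, hz⟩
      · refine Or.inl (Finset.mem_biUnion.2 ⟨h, Finset.mem_univ _, Finset.mem_image.2
          ⟨(t, i), Finset.mem_filter.2 ⟨Finset.mem_univ _, ?_⟩, he⟩⟩)
        rcases Sym2.eq_iff.1 he with ⟨h1, h2⟩ | ⟨h1, h2⟩
        · simpa only [h1, h2] using hxy
        · simpa only [h1, h2] using hxy.symm
      · exact Or.inr (Finset.mem_image.2 ⟨z, Finset.mem_univ _, hz⟩)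
  have hle := Nat.card_mono (Finset.finite_toSet _) hsub
  rw [Nat.card_coe_set_eq, Nat.card_coe_set_eq, Set.ncard_coe_finset, ← Nat.card_coe_set_eq] at hle
  have hA : ∀ h, (A h).card ≤ 7 := fun h =>
    Finset.card_image_le.trans (card_uncut_hat_le hU h)
  have hB : (Finset.univ.biUnion A).card ≤ 28 := by
    refine Finset.card_biUnion_le.trans ?_
    exact (Finset.sum_le_sum fun h _ => hA h).trans (by simp)
  have hC := Finset.card_union_le (Finset.univ.biUnion A) (Finset.univ.image rimPair)
  rw [card_image_rimPair] at hC
  -- Connectedness requires 35 uncut edges, but only 28 + 6 = 34 are available.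
  have h36 : Nat.card FaceIndex = 36 := by
    simp [FaceIndex]
  omega

end Counting

theorem mainTheorem1 :
    ∃ (V : Type) (_ : Fintype V) (_ : DecidableEq V) (P : TriPolyhedron V),
      P.IsTopologicallyConvex ∧
      (∀ f ∈ P.faces, P.IsAcuteFace f ∧ P.IsIsoscelesFace f) ∧
      P.IsUnunfoldable := by
  refine ⟨Fin 20, inferInstance, inferInstance, spiked, spiked_isTopologicallyConvex,
    fun f hf => ?_, spiked_isUnunfoldable⟩
  obtain ⟨x, rfl⟩ := mem_spikedFaces.1 hf
  exact ⟨spiked_isAcuteFace x, spiked_isIsoscelesFace x⟩
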